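/- Let $b_k>0$ and $q_k\in\mathbb R$ ($k\ge 1$). For a complex sequence $f=(f_k)_{k\ge1}$ put $(\gamma f)_1=q_1f_1+b_1f_2$ and $(\gamma f)_k=b_{k-1}f_{k-1}+q_kf_k+b_kf_{k+1}$ for $k\ge2$. The Jacobi operator $J$ is the closure in $\ell^2(\mathbb N)$ of the operator $f\mapsto\gamma f$ defined on the finitely supported sequences. Let $P_k(\zeta)$ be the polynomials such that $f_k=P_{k-1}(\zeta)$ solves $\gamma f=\zeta f$ with $f_1=1$, and $Q_k(\zeta)$ those such that $f_k=Q_{k-1}(\zeta)$ solves $(\gamma f)_k=\zeta f_k$ for $k\ge2$ with $f_1=0$, $f_2=1/b_1$. For $g\in\mathbb R\cup\{+\infty\}$ let $v_k(g)=P_{k-1}(0)+gQ_{k-1}(0)$ if $g\in\mathbb R$ and $v_k(+\infty)=Q_{k-1}(0)$, and let $W_n(\varphi,\psi)=b_n(\varphi_n\psi_{n+1}-\psi_n\varphi_{n+1})$. The operator $J(g)$ (Dirichlet condition at the origin) is $J$ if $J=J^*$, and otherwise the restriction of $J^*$ to $\{f\in\operatorname{dom}J^*:\lim_{n\to\infty}W_n(v(g),f)=0\}$.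 The operator $J_\infty(g)$ (Neumann condition at the origin) acts in the space of square summable sequences $(f_k)_{k\ge2}$ by $f\mapsto((\gamma f)_k)_{k\ge2}$ with $f_1:=0$, on the domain of those $f$ for which $((\gamma f)_k)_{k\ge 2}$ is square summable and, if $J\ne J^*$, $\lim_{n\to\infty}W_n(v(g),f)=0$. An operator has discrete spectrum if its spectrum consists of eigenvalues of finite multiplicity without finite accumulation point. **Theorem (Fu–Hochstadt, Teschl).** If $J(g)$ has discrete spectrum, the spectra $\sigma(J(g))$ and $\sigma(J_\infty(g))$ uniquely determine $J$ and, if $J\neq J^*$, the boundary condition $g$ at infinity. That is: let $J(g)$ and $J'(g')$ be two such operators, given by the matrix entries $(b_k,q_k)$ and $(b'_k,q'_k)$ and by $g,g'\in\mathbb R\cup\{+\infty\}$, both with discrete spectrum. If $\sigma(J(g))=\sigma(J'(g'))$ and $\sigma(J_\infty(g))=\sigma(J'_\infty(g'))$, then $b_k=b'_k$ and $q_k=q'_k$ for all $k\ge1$, and, if $J\ne J^*$, also $g=g'$. -/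

import Mathlib

open Filter Topology
open scoped ENNReal

noncomputable section

namespace JacobiTwoSpectra

/-- The Hilbert space `ℓ²` of complex square summable sequences. Sequences are indexed from `0`, so
the entry of index `k` here is the one traditionally denoted by `f_{k+1}`. -/
abbrev H : Type := lp (fun _ : ℕ => ℂ) 2

/-! ### Spectral notions for unbounded operators -/

/-- `z` is in the resolvent set of `A` if `A - z` is a bijection from the domain of `A` onto the
space, with bounded inverse `R`. -/
def resolventSet (A : H →ₗ.[ℂ] H) : Set ℂ :=
  {z | ∃ R : H →L[ℂ] H,
    (∀ x : H, ∃ h : R x ∈ A.domain, A ⟨R x, h⟩ - z • R x = x) ∧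
    (∀ y : A.domain, R (A y - z • (y : H)) = y)}

/-- The spectrum of an unbounded operator. -/
def spectrum (A : H →ₗ.[ℂ] H) : Set ℂ := (resolventSet A)ᶜ

/-- The eigenspace of `A` at `z`, as a subspace of the domain of `A`. -/
def eigenspace (A : H →ₗ.[ℂ] H) (z : ℂ) : Submodule ℂ A.domain :=
  LinearMap.ker (A.toFun - z • A.domain.subtype)

/-- Discrete spectrum: the spectrum consists of eigenvalues of finite multiplicity and has no
finite accumulation point. -/
def HasDiscreteSpectrum (A : H →ₗ.[ℂ] H) : Prop :=
  (∀ z ∈ spectrum A, eigenspace A z ≠ ⊥ ∧ FiniteDimensional ℂ (eigenspace A z)) ∧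
  ∀ z : ℂ, ¬ AccPt z (𝓟 (spectrum A))

/-! ### Jacobi matrices -/

/-- A semi-infinite Jacobi matrix with diagonal `q 0, q 1, …` (real) and off-diagonal
`b 0, b 1, …` (positive): `q k`, `b k` are traditionally denoted by `q_{k+1}`, `b_{k+1}`. -/
structure JacobiMatrix where
  q : ℕ → ℝ
  b : ℕ → ℝ
  b_pos : ∀ k, 0 < b k

namespace JacobiMatrix

variable (J : JacobiMatrix)

/-- The difference expression `γ`, i.e. the action of the matrix on arbitrary sequences. -/
def diffExpr (f : ℕ → ℂ) : ℕ → ℂ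
  | 0 => J.q 0 * f 0 + J.b 0 * f 1
  | k + 1 => J.b k * f k + J.q (k + 1) * f (k + 1) + J.b (k + 1) * f (k + 2)

theorem diffExpr_add (f g : ℕ → ℂ) : J.diffExpr (f + g) = J.diffExpr f + J.diffExpr g := by
  funext k
  cases k <;> simp [diffExpr] <;> ring

theorem diffExpr_smul (c : ℂ) (f : ℕ → ℂ) : J.diffExpr (c • f) = c • J.diffExpr f := by
  funext k
  cases k <;> simp [diffExpr] <;> ring

theorem diffExpr_zero : J.diffExpr 0 = 0 := by
  funext k
  cases k <;> simp [diffExpr]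

/-- The sequences with finitely many nonzero entries. -/
def finSeq : Submodule ℂ H where
  carrier := {f | (Function.support (f : ℕ → ℂ)).Finite}
  zero_mem' := by
    change (Function.support (0 : ℕ → ℂ)).Finite
    rw [Function.support_zero]
    exact Set.finite_empty
  add_mem' {f g} hf hg := by
    refine (Set.Finite.union hf hg).subset ?_
    rw [lp.coeFn_add]
    exact Function.support_add _ _
  smul_mem' c f hf := by
    refine Set.Finite.subset hf ?_
    rw [lp.coeFn_smul]
    exact Function.support_const_smul_subset c _

theorem memℓp_diffExpr_of_finite {f : ℕ → ℂ} (hf : (Function.support f).Finite) :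
    Memℓp (J.diffExpr f) 2 := by
  obtain ⟨N, hN⟩ := hf.bddAbove
  have h0 : ∀ k, N < k → f k = 0 := fun k hk => by
    by_contra h
    exact absurd (hN h) (by omega)
  refine (memℓp_zero ?_ : Memℓp (J.diffExpr f) 0).of_exponent_ge (by simp)
  refine (Set.finite_Iic (N + 1)).subset fun k hk => ?_
  by_contra hlt
  simp only [Set.mem_Iic, not_le] at hlt
  apply hk
  cases k with
  | zero => omega
  | succ k => simp [diffExpr, h0 k (by omega), h0 (k + 1) (by omega), h0 (k + 2) (by omega)]

/-- The symmetric operator given by the matrix on the finitely supported sequences. -/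
def preOperator : H →ₗ.[ℂ] H where
  domain := finSeq
  toFun :=
    { toFun := fun f => ⟨J.diffExpr (f : H), J.memℓp_diffExpr_of_finite f.2⟩
      map_add' := fun f g => Subtype.ext (J.diffExpr_add (f : H) (g : H))
      map_smul' := fun c f => Subtype.ext (J.diffExpr_smul c (f : H)) }

/-- The Jacobi operator `J`: the closure of the operator on the finitely supported sequences. -/
def operator : H →ₗ.[ℂ] H := J.preOperator.closure

/-- The operator `f ↦ γ f` on its maximal domain `{f ∈ ℓ² : γ f ∈ ℓ²}`. -/
def maximalOperator : H →ₗ.[ℂ] H where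
  domain :=
    { carrier := {f | Memℓp (J.diffExpr f) 2}
      zero_mem' := by
        change Memℓp (J.diffExpr 0) 2
        rw [diffExpr_zero]
        exact zero_memℓp
      add_mem' := fun {f g} hf hg => by
        change Memℓp (J.diffExpr ((f : ℕ → ℂ) + g)) 2
        rw [diffExpr_add]
        exact Memℓp.add hf hg
      smul_mem' := fun c f hf => by
        change Memℓp (J.diffExpr (c • (f : ℕ → ℂ))) 2
        rw [diffExpr_smul]
        exact Memℓp.const_smul hf c }
  toFun :=
    { toFun := fun f => ⟨J.diffExpr (f : H), f.2⟩
      map_add' := fun f g => Subtype.ext (J.diffExpr_add (f : H) (g : H))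
      map_smul' := fun c f => Subtype.ext (J.diffExpr_smul c (f : H)) }

/-- The orthogonal polynomials of the first kind: the solution of `γ f = ζ f` with first entry
`1`. -/
def P (ζ : ℂ) : ℕ → ℂ
  | 0 => 1
  | 1 => (ζ - J.q 0) / J.b 0
  | k + 2 => ((ζ - J.q (k + 1)) * P ζ (k + 1) - J.b k * P ζ k) / J.b (k + 1)

/-- The polynomials of the second kind: the solution of `(γ f)_k = ζ f_k`, for all `k` but the
first, with first entry `0` and second entry `1 / b 0`. -/
def Q (ζ : ℂ) : ℕ → ℂ
  | 0 => 0
  | 1 => 1 / J.b 0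
  | k + 2 => ((ζ - J.q (k + 1)) * Q ζ (k + 1) - J.b k * Q ζ k) / J.b (k + 1)

theorem diffExpr_P (ζ : ℂ) (k : ℕ) : J.diffExpr (J.P ζ) k = ζ * J.P ζ k := by
  have hb : ∀ k, (J.b k : ℂ) ≠ 0 := fun k => by exact_mod_cast (J.b_pos k).ne'
  cases k with
  | zero => simp only [diffExpr, P]; field_simp [hb 0]; ring
  | succ k => simp only [diffExpr, P]; field_simp [hb (k + 1)]; ring

theorem diffExpr_Q (ζ : ℂ) (k : ℕ) : J.diffExpr (J.Q ζ) (k + 1) = ζ * J.Q ζ (k + 1) := by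
  have hb : ∀ k, (J.b k : ℂ) ≠ 0 := fun k => by exact_mod_cast (J.b_pos k).ne'
  simp only [diffExpr, Q]; field_simp [hb (k + 1)]; ring

/-- The Wronskian of two sequences. -/
def wronskian (φ ψ : ℕ → ℂ) (k : ℕ) : ℂ := J.b k * (φ k * ψ (k + 1) - ψ k * φ (k + 1))

/-- The boundary sequence `v(g)`, for `g ∈ ℝ ∪ {+∞}`. -/
def boundarySeq : WithTop ℝ → ℕ → ℂ
  | ⊤, k => J.Q 0 k
  | (g : ℝ), k => J.P 0 k + (g : ℂ) * J.Q 0 k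

/-- The subspace of `ℓ²` cut out by the boundary condition at infinity `W_n(v(g), f) → 0`. -/
def boundaryCondition (g : WithTop ℝ) : Submodule ℂ H where
  carrier := {f | Tendsto (J.wronskian (J.boundarySeq g) f) atTop (𝓝 0)}
  zero_mem' := by
    have h : J.wronskian (J.boundarySeq g) ((0 : H) : ℕ → ℂ) = fun _ => 0 := by
      funext k; simp [wronskian]
    change Tendsto _ _ _
    rw [h]
    exact tendsto_const_nhds
  add_mem' {f₁ f₂} h₁ h₂ := by
    have h := Tendsto.add (f := J.wronskian (J.boundarySeq g) f₁)
      (g := J.wronskian (J.boundarySeq g) f₂) h₁ h₂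
    rw [add_zero] at h
    refine h.congr fun k => ?_
    simp [wronskian]; ring
  smul_mem' c f hf := by
    have h := Tendsto.const_mul (f := J.wronskian (J.boundarySeq g) f) c hf
    rw [mul_zero] at h
    refine h.congr fun k => ?_
    simp [wronskian]; ring

open Classical in
/-- The operator `J(g)`: the operator `J` itself if `J = J*`, and otherwise the restriction of `J*`
to the `f` in its domain that satisfy the boundary condition `g` at infinity. -/
def dirichletOperator (g : WithTop ℝ) : H →ₗ.[ℂ] H :=
  if IsSelfAdjoint J.operator then J.operator
  else J.operator.adjoint.domRestrict (J.boundaryCondition g)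

/-- The Jacobi matrix with the first row and column removed. -/
def tail : JacobiMatrix where
  q k := J.q (k + 1)
  b k := J.b (k + 1)
  b_pos k := J.b_pos (k + 1)

/-- A sequence `f_2, f_3, …` completed by `f_1 = 0`. -/
def consZero (f : ℕ → ℂ) : ℕ → ℂ
  | 0 => 0
  | k + 1 => f k

/-- The truncated matrix acts as `γ` on the sequences with first entry `0`, the first entry of the
result being dropped. -/
theorem tail_diffExpr (f : ℕ → ℂ) (k : ℕ) :
    J.tail.diffExpr f k = J.diffExpr (consZero f) (k + 1) := by
  cases k <;> simp [diffExpr, tail, consZero]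

/-- The subspace of `ℓ²`, seen as the space of the square summable sequences `f_2, f_3, …`, cut out
by the boundary condition at infinity `W_n(v(g), f) → 0` of the full matrix. -/
def tailBoundaryCondition (g : WithTop ℝ) : Submodule ℂ H where
  carrier := {f | Tendsto (J.wronskian (J.boundarySeq g) (consZero f)) atTop (𝓝 0)}
  zero_mem' := by
    have h : J.wronskian (J.boundarySeq g) (consZero ((0 : H) : ℕ → ℂ)) = fun _ => 0 := by
      funext k; cases k <;> simp [wronskian, consZero]
    change Tendsto _ _ _
    rw [h]
    exact tendsto_const_nhds
  add_mem' {f₁ f₂} h₁ h₂ := by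
    have h := Tendsto.add (f := J.wronskian (J.boundarySeq g) (consZero f₁))
      (g := J.wronskian (J.boundarySeq g) (consZero f₂)) h₁ h₂
    rw [add_zero] at h
    refine h.congr fun k => ?_
    cases k <;> simp [wronskian, consZero] <;> ring
  smul_mem' c f hf := by
    have h := Tendsto.const_mul (f := J.wronskian (J.boundarySeq g) (consZero f)) c hf
    rw [mul_zero] at h
    refine h.congr fun k => ?_
    cases k <;> simp [wronskian, consZero] <;> ring

open Classical in
/-- The operator `J_∞(g)` in the space of the square summable sequences `f_2, f_3, …`: it acts by
`γ` with `f_1 = 0`, that is, by the truncated matrix, on the `f` with `γ f ∈ ℓ²` that satisfy, if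
`J ≠ J*`, the boundary condition `g` at infinity. No boundary condition at infinity is imposed if
`J = J*`. -/
def neumannOperator (g : WithTop ℝ) : H →ₗ.[ℂ] H :=
  if IsSelfAdjoint J.operator then J.tail.maximalOperator
  else J.tail.maximalOperator.domRestrict (J.tailBoundaryCondition g)

end JacobiMatrix

end JacobiTwoSpectra

end

noncomputable section

namespace JacobiTwoSpectra

open scoped ComplexConjugate InnerProductSpace

/-! Both spectra are encoded in the Weyl function m(z) = ⟨e₀, (J(g) - z)⁻¹ e₀⟩. Eliminating every
row but the first gives 1/m(z) = q₀ - z - b₀² m₁(z), with m₁ the Weyl function of J_∞(g)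
(`apply_zero_mul_weylInv`). Since the spectrum of J(g) is discrete, its points are the poles of m
and those of J_∞(g) are the zeros (`isWeylPair`); both are real and simple, because Im m(z) is a
positive multiple of Im z and m, -1/m increase along the real line.

The quotient of two Weyl functions with the same zeros and poles therefore extends to an entire
function without real zeros. It is real on the real line and positive at a pole, hence positive on
the whole line. Off the line both imaginary parts have the sign of Im z, so the quotient is never a
nonpositive number. It takes values in the slit plane, and Liouville's theorem applied to its square
root shows that it is constant (`IsWeylPair.eq_const_mul`). The normalization 1/m(z) = -z + q₀ +
o(1) along the imaginary axis makes the constant 1.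

From m one reads off q₀ and b₀² m₁, and the same normalization of m₁ separates b₀; repeating this
for the truncated matrices recovers all entries (`entries_eq_of_weylFn`). If J ≠ J*, then m(i) also
determines (J(g) - i)⁻¹ e₀. Were this vector to satisfy two boundary conditions, its Wronskian with
P(i) would tend to 0, whereas it is constantly -1.

The cases J = J* and J ≠ J* are treated together: a subspace D stands for the condition at infinity,
and `IsRealization` records what is needed and survives removal of a row. -/

/-! ### Resolvents of unbounded operators -/

/-- `R` is the resolvent of `A` at `z`. -/
def IsResolvent (A : H →ₗ.[ℂ] H) (z : ℂ) (R : H →L[ℂ] H) : Prop :=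
  (∀ x : H, ∃ h : R x ∈ A.domain, A ⟨R x, h⟩ - z • R x = x) ∧
    ∀ y : A.domain, R (A y - z • (y : H)) = y

open Classical in
/-- The resolvent of `A` at `z`, with value `0` outside of the resolvent set. -/
def resolvent (A : H →ₗ.[ℂ] H) (z : ℂ) : H →L[ℂ] H :=
  if h : z ∈ resolventSet A then h.choose else 0

variable {A : H →ₗ.[ℂ] H} {z : ℂ} {R : H →L[ℂ] H}

theorem isResolvent_resolvent (h : z ∈ resolventSet A) : IsResolvent A z (resolvent A z) := by
  rw [resolvent, dif_pos h]
  exact h.choose_spec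

theorem exists_apply_sub_eq {x k : H} (y : A.domain) (h1 : (y : H) = x)
    (h2 : A y - z • (y : H) = k) : ∃ h : x ∈ A.domain, A ⟨x, h⟩ - z • x = k := by
  subst h1
  exact ⟨y.2, h2⟩

theorem IsResolvent.mem (h : IsResolvent A z R) : z ∈ resolventSet A := ⟨R, h⟩

theorem IsResolvent.unique {R' : H →L[ℂ] H} (h : IsResolvent A z R) (h' : IsResolvent A z R') :
    R = R' := by
  ext1 x
  obtain ⟨hx, hx'⟩ := h.1 x
  have := h'.2 ⟨R x, hx⟩
  rw [hx'] at this
  exact this.symm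

theorem IsResolvent.eq_resolvent (h : IsResolvent A z R) : resolvent A z = R :=
  (isResolvent_resolvent h.mem).unique h

theorem IsResolvent.ne_zero (h : IsResolvent A z R) {x : H} (hx : x ≠ 0) : R x ≠ 0 := by
  intro h0
  obtain ⟨h1, h2⟩ := h.1 x
  have : (⟨R x, h1⟩ : A.domain) = 0 := Subtype.ext h0
  rw [this, LinearPMap.map_zero, h0] at h2
  simp at h2
  exact hx h2.symm

/-- On the domain, A - (z + c) = (1 - cR)(A - z), so inverting the bounded factor suffices. -/
theorem IsResolvent.add_of_inverse (h : IsResolvent A z R) (c : ℂ) {W : H →L[ℂ] H}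
    (h1 : (1 - c • R) * W = 1) (h2 : W * (1 - c • R) = 1) : IsResolvent A (z + c) (R * W) := by
  constructor
  · intro x
    obtain ⟨hx, hx'⟩ := h.1 (W x)
    refine ⟨hx, ?_⟩
    have := DFunLike.congr_fun h1 x
    simp only [mul_apply_eq_comp, sub_apply,
      one_apply_eq_self, smul_apply] at this ⊢
    rw [add_smul, ← sub_sub, hx', this]
  · intro y
    have hy := h.2 y
    have := DFunLike.congr_fun h2 (A y - z • (y : H))
    simp only [mul_apply_eq_comp, sub_apply,
      one_apply_eq_self, smul_apply] at this ⊢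
    rw [hy] at this
    rw [add_smul, ← sub_sub, this, hy]

theorem IsResolvent.add_of_isUnit (h : IsResolvent A z R) {c : ℂ} (hc : IsUnit (1 - c • R)) :
    IsResolvent A (z + c) (R * Ring.inverse (1 - c • R)) :=
  h.add_of_inverse c (Ring.mul_inverse_cancel _ hc) (Ring.inverse_mul_cancel _ hc)

theorem IsResolvent.eventually (h : IsResolvent A z R) :
    ∀ᶠ ζ in 𝓝 z, IsResolvent A ζ (R * Ring.inverse (1 - (ζ - z) • R)) := by
  have hc : Tendsto (fun ζ : ℂ => 1 - (ζ - z) • R) (𝓝 z) (𝓝 1) := by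
    have : Continuous (fun ζ : ℂ => 1 - (ζ - z) • R) := by fun_prop
    simpa using this.tendsto z
  have hu : ∀ᶠ ζ in 𝓝 z, IsUnit (1 - (ζ - z) • R) := hc.eventually (Units.nhds 1)
  filter_upwards [hu] with ζ hζ
  simpa using h.add_of_isUnit hζ

theorem isOpen_resolventSet (A : H →ₗ.[ℂ] H) : IsOpen (resolventSet A) := by
  refine isOpen_iff_mem_nhds.2 fun z hz => ?_
  filter_upwards [(isResolvent_resolvent hz).eventually] with ζ hζ using hζ.mem

theorem hasDerivAt_resolvent (hz : z ∈ resolventSet A) :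
    HasDerivAt (resolvent A) (resolvent A z * resolvent A z) z := by
  set R := resolvent A z
  have h := isResolvent_resolvent hz
  have h1 : HasDerivAt (fun ζ : ℂ => 1 - (ζ - z) • R) (-R) z := by
    simpa using (((hasDerivAt_id z).sub_const z).smul_const R).const_sub 1
  have h2 : HasFDerivAt (Ring.inverse : (H →L[ℂ] H) → _)
      (-ContinuousLinearMap.mulLeftRight ℂ (H →L[ℂ] H) 1 1) (1 - (z - z) • R) := by
    simpa using hasFDerivAt_ringInverse (𝕜 := ℂ) (1 : (H →L[ℂ] H)ˣ)
  have h3 := (h2.comp_hasDerivAt z h1).const_mul R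
  refine (h3.congr_deriv (by simp [ContinuousLinearMap.mulLeftRight_apply])).congr_of_eventuallyEq ?_
  filter_upwards [h.eventually] with ζ hζ using hζ.eq_resolvent

/-! ### Symmetric operators -/

theorem IsResolvent.inner_eq (hA : A.IsFormalAdjoint A) {R' : H →L[ℂ] H}
    (h : IsResolvent A z R) (h' : IsResolvent A (conj z) R') (x y : H) :
    ⟪R x, y⟫_ℂ = ⟪x, R' y⟫_ℂ := by
  obtain ⟨hx, hx'⟩ := h.1 x
  obtain ⟨hy, hy'⟩ := h'.1 y
  have := hA ⟨R x, hx⟩ ⟨R' y, hy⟩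
  dsimp only at this
  conv_lhs => rw [← hy']
  conv_rhs => rw [← hx']
  rw [inner_sub_left, inner_sub_right, this, inner_smul_left, inner_smul_right]

theorem IsResolvent.isSelfAdjoint (hA : A.IsFormalAdjoint A) (h : IsResolvent A z R)
    (hz : conj z = z) : IsSelfAdjoint R := by
  rw [ContinuousLinearMap.isSelfAdjoint_iff_isSymmetric]
  intro x y
  exact h.inner_eq hA (hz.symm ▸ h) x y

theorem im_inner_self_of_symmetric (hA : A.IsFormalAdjoint A) (y : A.domain) :
    (⟪A y, (y : H)⟫_ℂ).im = 0 := by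
  have := hA y y
  rw [← inner_conj_symm] at this
  have h2 := congrArg Complex.im this
  rw [Complex.conj_im] at h2
  rw [← inner_conj_symm, Complex.conj_im]
  linarith

/-- The inner product is conjugate linear on the left, so -z contributes -conj z, whose imaginary
part is +Im z. This identity is the source of real eigenvalues, the resolvent bound 1/|Im z| and the
sign of Im m. -/
theorem im_inner_sub_smul (hA : A.IsFormalAdjoint A) (z : ℂ) (y : A.domain) :
    (⟪A y - z • (y : H), (y : H)⟫_ℂ).im = z.im * ‖(y : H)‖ ^ 2 := by
  rw [inner_sub_left, inner_smul_left, inner_self_eq_norm_sq_to_K, Complex.sub_im,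
    im_inner_self_of_symmetric hA]
  have : ((‖(y : H)‖ : ℂ) ^ 2).im = 0 := by rw [← Complex.ofReal_pow, Complex.ofReal_im]
  have h2 : ((‖(y : H)‖ : ℂ) ^ 2).re = ‖(y : H)‖ ^ 2 := by
    rw [← Complex.ofReal_pow, Complex.ofReal_re]
  simp only [Complex.coe_algebraMap, Complex.mul_im, Complex.conj_im, Complex.conj_re, this, h2]
  ring

theorem IsResolvent.im_inner (hA : A.IsFormalAdjoint A) (h : IsResolvent A z R) (x : H) :
    (⟪x, R x⟫_ℂ).im = z.im * ‖R x‖ ^ 2 := by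
  obtain ⟨hx, hx'⟩ := h.1 x
  have := im_inner_sub_smul hA z ⟨R x, hx⟩
  dsimp only at this
  rwa [hx'] at this

theorem IsResolvent.norm_le (hA : A.IsFormalAdjoint A) (h : IsResolvent A z R) (x : H) :
    |z.im| * ‖R x‖ ≤ ‖x‖ := by
  rcases eq_or_ne (‖R x‖) 0 with h0 | h0
  · rw [h0]; simp
  have h1 := h.im_inner hA x
  have h2 : |(⟪x, R x⟫_ℂ).im| ≤ ‖x‖ * ‖R x‖ :=
    (Complex.abs_im_le_norm _).trans (norm_inner_le_norm _ _)
  rw [h1, abs_mul, abs_of_nonneg (by positivity : 0 ≤ ‖R x‖ ^ 2)] at h2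
  have h3 : 0 < ‖R x‖ := lt_of_le_of_ne (norm_nonneg _) h0.symm
  nlinarith

theorem eigenvalue_im_eq_zero (hA : A.IsFormalAdjoint A) {y : A.domain} (hy : (y : H) ≠ 0)
    (h : A y = z • (y : H)) : z.im = 0 := by
  have := im_inner_sub_smul hA z y
  rw [h, sub_self, inner_zero_left, Complex.zero_im] at this
  have h2 : 0 < ‖(y : H)‖ := norm_pos_iff.2 hy
  rcases mul_eq_zero.1 this.symm with h3 | h3
  · exact h3
  · exact absurd h3 (by positivity)

/-! ### The Weyl function -/

/-- The first unit vector. -/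
def e0 : H := lp.single 2 0 1

/-- The Weyl function `z ↦ ⟨e₀, (A - z)⁻¹ e₀⟩`. -/
def weyl (A : H →ₗ.[ℂ] H) (z : ℂ) : ℂ := ⟪e0, resolvent A z e0⟫_ℂ

theorem inner_e0_left (f : H) : ⟪e0, f⟫_ℂ = f 0 := by
  rw [e0, lp.inner_single_left]; simp

theorem inner_e0_right (f : H) : ⟪f, e0⟫_ℂ = conj (f 0) := by
  rw [← inner_conj_symm, inner_e0_left]

theorem norm_e0 : ‖e0‖ = 1 := by
  rw [e0, lp.norm_single (by simp)]; simp

theorem e0_ne_zero : e0 ≠ 0 := norm_ne_zero_iff.1 (by rw [norm_e0]; exact one_ne_zero)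

theorem e0_apply (k : ℕ) : e0 k = if k = 0 then 1 else 0 := by
  rw [e0, lp.single_apply]
  by_cases h : k = 0
  · subst h; simp
  · simp [h]

theorem weyl_eq_apply : weyl A z = resolvent A z e0 0 := inner_e0_left _

theorem hasDerivAt_weyl (hz : z ∈ resolventSet A) :
    HasDerivAt (weyl A) ⟪e0, resolvent A z (resolvent A z e0)⟫_ℂ z := by
  have h1 := (ContinuousLinearMap.apply ℂ H e0).hasFDerivAt.comp_hasDerivAt z
    (hasDerivAt_resolvent hz)
  have h2 := (innerSL ℂ e0).hasFDerivAt.comp_hasDerivAt z h1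
  exact h2

theorem im_weyl (hA : A.IsFormalAdjoint A) (hz : z ∈ resolventSet A) :
    (weyl A z).im = z.im * ‖resolvent A z e0‖ ^ 2 :=
  (isResolvent_resolvent hz).im_inner hA e0

theorem norm_resolvent_e0_pos (hz : z ∈ resolventSet A) : 0 < ‖resolvent A z e0‖ :=
  norm_pos_iff.2 ((isResolvent_resolvent hz).ne_zero e0_ne_zero)

/-- At real points, the Weyl function has positive derivative. -/
theorem hasDerivAt_weyl_real (hA : A.IsFormalAdjoint A) (hz : z ∈ resolventSet A) (hr : z.im = 0) :
    HasDerivAt (weyl A) ((‖resolvent A z e0‖ ^ 2 : ℝ) : ℂ) z := by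
  refine (hasDerivAt_weyl hz).congr_deriv ?_
  have h := isResolvent_resolvent hz
  have hz' : conj z = z := Complex.conj_eq_iff_im.2 hr
  rw [← h.inner_eq hA (hz'.symm ▸ h), inner_self_eq_norm_sq_to_K]
  simp

theorem norm_weyl_le (hA : A.IsFormalAdjoint A) (hz : z ∈ resolventSet A) :
    |z.im| * ‖weyl A z‖ ≤ 1 := by
  have h1 : ‖weyl A z‖ ≤ ‖e0‖ * ‖resolvent A z e0‖ := norm_inner_le_norm _ _
  have h2 := (isResolvent_resolvent hz).norm_le hA e0
  rw [norm_e0] at h1 h2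
  exact (mul_le_mul_of_nonneg_left h1 (abs_nonneg _)).trans (by simpa using h2)

/-! ### Real points of the spectrum of a symmetric operator -/

/-- This is the first resolvent identity R' - R = ζ⁻¹ R R'. -/
theorem IsResolvent.mul_eq_one {μ ζ : ℂ} {R' : H →L[ℂ] H} (h : IsResolvent A μ R)
    (h' : IsResolvent A (μ + ζ⁻¹) R') : (1 - ζ⁻¹ • R) * (1 + ζ⁻¹ • R') = 1 := by
  ext1 x
  obtain ⟨hx, hx'⟩ := h'.1 x
  have h3 := h.2 ⟨_, hx⟩
  rw [add_smul, ← sub_sub, sub_eq_iff_eq_add] at hx'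
  rw [hx', map_add, map_smul] at h3
  simp only [mul_apply_eq_comp, sub_apply, add_apply, smul_apply, one_apply_eq_self, map_add,
    map_smul]
  have h4 : R' x = R x + ζ⁻¹ • R (R' x) := h3.symm
  linear_combination (norm := module) ζ⁻¹ • h4

theorem IsResolvent.notMem_spectrum {μ ζ : ℂ} {R' : H →L[ℂ] H} (h : IsResolvent A μ R)
    (hζ : ζ ≠ 0) (h' : IsResolvent A (μ + ζ⁻¹) R') : ζ ∉ _root_.spectrum ℂ R := by
  have k1 := h.mul_eq_one h'
  -- Exchanging the two base points replaces ζ by -ζ and gives the product in the other order.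
  have k2 := h'.mul_eq_one (ζ := -ζ) (R' := R) (by simpa [inv_neg] using h)
  rw [inv_neg, neg_smul, sub_neg_eq_add, neg_smul, ← sub_eq_add_neg] at k2
  have hu : IsUnit (1 - ζ⁻¹ • R) := ⟨⟨_, _, k1, k2⟩, rfl⟩
  rw [_root_.spectrum.notMem_iff, Algebra.algebraMap_eq_smul_one]
  have : ζ • (1 : H →L[ℂ] H) - R = Units.mk0 ζ hζ • (1 - ζ⁻¹ • R) := by
    rw [Units.smul_mk0, smul_sub, smul_smul, mul_inv_cancel₀ hζ, one_smul]
  rw [this]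
  exact hu.smul _

/-- With empty spectrum, the self-adjoint operator A⁻¹ would have spectrum in {0}, hence norm 0,
contradicting its injectivity. This supplies the pole at which the sign of the quotient is fixed. -/
theorem spectrum_nonempty (hA : A.IsFormalAdjoint A) : (spectrum A).Nonempty := by
  by_contra hne
  rw [Set.not_nonempty_iff_eq_empty, spectrum, Set.compl_empty_iff] at hne
  have hall : ∀ z, z ∈ resolventSet A := fun z => hne ▸ Set.mem_univ z
  have h := isResolvent_resolvent (hall 0)
  have hrad := (h.isSelfAdjoint hA (by simp)).spectralRadius_eq_nnnorm
  have h0 : spectralRadius ℂ (resolvent A 0) = 0 := by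
    refine le_antisymm (iSup₂_le fun ζ hζ => ?_) bot_le
    have : ζ = 0 := by
      by_contra hne
      exact h.notMem_spectrum hne (isResolvent_resolvent (hall _)) hζ
    simp [this]
  rw [h0] at hrad
  have hR : resolvent A 0 = 0 := by simpa using hrad.symm
  exact h.ne_zero e0_ne_zero (by rw [hR]; rfl)

/-- The continuous functional calculus provides a generalized inverse of `T - c` for `c` an isolated
point of the spectrum. -/
theorem exists_generalized_inverse {T : H →L[ℂ] H} (hT : IsStarNormal T) {c : ℂ}
    (hiso : ∀ᶠ ζ in 𝓝 c, ζ ∈ _root_.spectrum ℂ T → ζ = c) :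
    ∃ S : H →L[ℂ] H, (T - c • 1) * ((T - c • 1) * S) = T - c • 1 := by
  -- At ζ = c the function has the default value 0; it is still continuous on the spectrum because c
  -- is isolated there.
  have hcont : ContinuousOn (fun ζ : ℂ => (ζ - c)⁻¹) (_root_.spectrum ℂ T) := by
    intro x hx
    rcases eq_or_ne x c with rfl | hne
    · have : 𝓝[_root_.spectrum ℂ T] x = pure x := by
        refine le_antisymm ?_ (pure_le_nhdsWithin hx)
        rw [le_pure_iff, mem_nhdsWithin_iff_eventually]
        exact hiso
      rw [ContinuousWithinAt, this]
      exact tendsto_pure_nhds _ _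
    · have h1 : ContinuousAt (fun ζ : ℂ => ζ - c) x := by fun_prop
      exact (h1.inv₀ (sub_ne_zero.2 hne)).continuousWithinAt
  have hsub : ContinuousOn (fun ζ : ℂ => ζ - c) (_root_.spectrum ℂ T) := by fun_prop
  have hB : T - c • 1 = cfc (fun ζ : ℂ => ζ - c) T := by
    rw [cfc_sub (fun ζ : ℂ => ζ) (fun _ => c) T, cfc_id' ℂ T, cfc_const c T,
      Algebra.algebraMap_eq_smul_one]
  refine ⟨cfc (fun ζ : ℂ => (ζ - c)⁻¹) T, ?_⟩
  have hmul : ContinuousOn (fun ζ : ℂ => (ζ - c) * (ζ - c)⁻¹) (_root_.spectrum ℂ T) :=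
    hsub.mul hcont
  rw [hB, ← cfc_mul _ _ T hsub hcont, ← cfc_mul _ _ T hsub hmul]
  refine cfc_congr fun x _ => ?_
  rcases eq_or_ne (x - c) 0 with h | h
  · simp [h]
  · field_simp

/-- At an isolated real point of the spectrum, `A - z` has a bounded right inverse on the
orthogonal complement of its kernel. -/
theorem exists_reduced_resolvent (hA : A.IsFormalAdjoint A) (hr : z.im = 0)
    (hacc : ¬ AccPt z (𝓟 (spectrum A))) :
    ∃ S : H →L[ℂ] H, ∀ k : H, (∀ u : A.domain, A u = z • (u : H) → ⟪(u : H), k⟫_ℂ = 0) →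
      ∃ h : S k ∈ A.domain, A ⟨S k, h⟩ - z • S k = k := by
  have hev : ∀ᶠ ζ in 𝓝 z, ζ ≠ z → ζ ∈ resolventSet A := by
    rw [accPt_iff_frequently, not_frequently] at hacc
    filter_upwards [hacc] with ζ h1 h2
    by_contra h3
    exact h1 ⟨h2, h3⟩
  -- A real shift makes the resolvent T at z - c self-adjoint; the point z of A then corresponds to
  -- the point c⁻¹ of T, again isolated.
  obtain ⟨c, hc0, hcz⟩ : ∃ c : ℝ, c ≠ 0 ∧ z - c ∈ resolventSet A := by
    have h1 : Tendsto (fun c : ℝ => z - c) (𝓝[≠] 0) (𝓝 z) := by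
      have : Continuous (fun c : ℝ => z - c) := by fun_prop
      simpa using (this.tendsto 0).mono_left nhdsWithin_le_nhds
    obtain ⟨c, h2, h3⟩ := ((h1.eventually hev).and self_mem_nhdsWithin).exists
    exact ⟨c, h3, h2 (by simpa using h3)⟩
  have hc0' : (c : ℂ) ≠ 0 := by exact_mod_cast hc0
  have hT := isResolvent_resolvent hcz
  set T := resolvent A (z - c)
  have hsa : IsSelfAdjoint T := hT.isSelfAdjoint hA (Complex.conj_eq_iff_im.2 (by simp [hr]))
  have hiso : ∀ᶠ ζ : ℂ in 𝓝 (c : ℂ)⁻¹, ζ ∈ _root_.spectrum ℂ T → ζ = (c : ℂ)⁻¹ := by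
    have h1 : Tendsto (fun ζ : ℂ => z - c + ζ⁻¹) (𝓝 (c : ℂ)⁻¹) (𝓝 z) := by
      have : ContinuousAt (fun ζ : ℂ => z - c + ζ⁻¹) (c : ℂ)⁻¹ :=
        continuousAt_const.add (continuousAt_id.inv₀ (inv_ne_zero hc0'))
      simpa [ContinuousAt] using this
    filter_upwards [h1.eventually hev, eventually_ne_nhds (inv_ne_zero hc0')] with x hx hx0 hxs
    by_contra hxc
    refine hT.notMem_spectrum hx0 (isResolvent_resolvent (hx fun h => hxc ?_)) hxs
    rw [← inv_inv x]
    congr 1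
    linear_combination h
  obtain ⟨S₀, hS₀⟩ := exists_generalized_inverse hsa.isStarNormal hiso
  set B := T - (c : ℂ)⁻¹ • (1 : H →L[ℂ] H) with hBdef
  have hBapp : ∀ x, B x = T x - (c : ℂ)⁻¹ • x := fun x => by simp [hBdef]
  have hBsa : IsSelfAdjoint B := by
    refine hsa.sub (IsSelfAdjoint.smul ?_ (IsSelfAdjoint.one _))
    rw [← Complex.ofReal_inv]
    exact Complex.conj_ofReal _
  have hker : ∀ d : H, B d = 0 → ∃ h : d ∈ A.domain, A ⟨d, h⟩ = z • d := by
    intro d hd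
    obtain ⟨h1, h2⟩ := hT.1 ((c : ℂ) • d)
    have h3 : T ((c : ℂ) • d) = d := by
      rw [hBapp, sub_eq_zero] at hd
      rw [map_smul, hd, smul_smul, mul_inv_cancel₀ hc0', one_smul]
    simp only [h3] at h1 h2
    refine ⟨h1, ?_⟩
    rw [sub_smul, sub_eq_iff_eq_add] at h2
    rw [h2]
    abel
  -- By B²S₀ = B the error B S₀ k - k lies in ker B. It is orthogonal to k by assumption and to the
  -- range of B by self-adjointness, hence to itself.
  have hright : ∀ k : H, (∀ u : A.domain, A u = z • (u : H) → ⟪(u : H), k⟫_ℂ = 0) →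
      B (S₀ k) = k := by
    intro k hk
    have h1 : B (B (S₀ k) - k) = 0 := by
      rw [map_sub, sub_eq_zero]
      exact DFunLike.congr_fun hS₀ k
    obtain ⟨h2, h3⟩ := hker _ h1
    have h4 := hk ⟨_, h2⟩ h3
    have h5 : ⟪B (S₀ k) - k, B (S₀ k)⟫_ℂ = 0 := by
      rw [← ContinuousLinearMap.adjoint_inner_left, hBsa.adjoint_eq, h1, inner_zero_left]
    rw [← sub_eq_zero, ← inner_self_eq_zero (𝕜 := ℂ), inner_sub_right, h5, h4, sub_zero]
  -- The factor comes from (A - z)T = 1 - cT = -cB.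
  refine ⟨(-(c : ℂ)⁻¹) • (T * S₀), fun k hk => ?_⟩
  have h0 := hright k hk
  obtain ⟨h1, h2⟩ := hT.1 (S₀ k)
  have h3 := LinearPMap.map_smul A (-(c : ℂ)⁻¹) ⟨_, h1⟩
  refine exists_apply_sub_eq ((-(c : ℂ)⁻¹) • (⟨_, h1⟩ : A.domain)) rfl ?_
  rw [hBapp] at h0
  rw [h3]
  simp only [SetLike.val_smul]
  linear_combination (norm := module) (-(c : ℂ)⁻¹) • h2 + h0 + (inv_mul_cancel₀ hc0') • T (S₀ k)

namespace JacobiMatrix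

variable (J : JacobiMatrix)

theorem b_ne_zero (k : ℕ) : (J.b k : ℂ) ≠ 0 := by exact_mod_cast (J.b_pos k).ne'

@[simp]
theorem maximalOperator_apply (f : J.maximalOperator.domain) :
    ((J.maximalOperator f : H) : ℕ → ℂ) = J.diffExpr (f : H) := rfl

theorem mem_maximalOperator_domain {f : H} :
    f ∈ J.maximalOperator.domain ↔ Memℓp (J.diffExpr f) 2 := Iff.rfl

theorem mem_maximalOperator_domain_of_eq {f w : H} (h : J.diffExpr f = w) :
    ∃ hf : f ∈ J.maximalOperator.domain, J.maximalOperator ⟨f, hf⟩ = w :=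
  ⟨by rw [mem_maximalOperator_domain, h]; exact lp.memℓp w, lp.ext h⟩

/-! ### Solutions of the difference equation -/

theorem eq_zero_of_diffExpr_eq {z : ℂ} {f : ℕ → ℂ} (hf : ∀ k, J.diffExpr f k = z * f k)
    (h0 : f 0 = 0) : f = 0 := by
  have key : ∀ k, f k = 0 ∧ f (k + 1) = 0 := by
    intro k
    induction k with
    | zero =>
      refine ⟨h0, ?_⟩
      have := hf 0
      simp only [diffExpr, h0, mul_zero, zero_add] at this
      exact (mul_eq_zero.1 this).resolve_left (J.b_ne_zero 0)
    | succ k ih =>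
      refine ⟨ih.2, ?_⟩
      have := hf (k + 1)
      simp only [diffExpr, ih.1, ih.2, mul_zero, zero_add] at this
      exact (mul_eq_zero.1 this).resolve_left (J.b_ne_zero (k + 1))
  exact funext fun k => (key k).1

theorem eq_smul_P {z : ℂ} {f : ℕ → ℂ} (hf : ∀ k, J.diffExpr f k = z * f k) :
    f = f 0 • J.P z := by
  rw [← sub_eq_zero]
  refine J.eq_zero_of_diffExpr_eq (z := z) (fun k => ?_) (by simp [P])
  have h1 : f - f 0 • J.P z = f + (-f 0) • J.P z := by rw [neg_smul, sub_eq_add_neg]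
  rw [h1, diffExpr_add, diffExpr_smul]
  simp only [Pi.add_apply, Pi.smul_apply, smul_eq_mul, hf, diffExpr_P]
  ring

theorem diffExpr_conj (f : ℕ → ℂ) (k : ℕ) :
    J.diffExpr (fun i => conj (f i)) k = conj (J.diffExpr f k) := by
  cases k <;> simp [diffExpr]

theorem P_conj (z : ℂ) : J.P (conj z) = fun k => conj (J.P z k) := by
  have := J.eq_smul_P (z := conj z) (f := fun k => conj (J.P z k))
    (fun k => by rw [diffExpr_conj, diffExpr_P, map_mul])
  rw [this]
  simp [P]

/-! ### The Wronskian -/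

theorem wronskian_zero (φ ψ : ℕ → ℂ) :
    J.wronskian φ ψ 0 = φ 0 * J.diffExpr ψ 0 - ψ 0 * J.diffExpr φ 0 := by
  simp only [wronskian, diffExpr]; ring

theorem wronskian_succ (φ ψ : ℕ → ℂ) (n : ℕ) : J.wronskian φ ψ (n + 1) = J.wronskian φ ψ n +
    (φ (n + 1) * J.diffExpr ψ (n + 1) - ψ (n + 1) * J.diffExpr φ (n + 1)) := by
  simp only [wronskian, diffExpr]; ring

/-- Green's formula. -/
theorem wronskian_eq_sum (φ ψ : ℕ → ℂ) (n : ℕ) : J.wronskian φ ψ n =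
    ∑ k ∈ Finset.range (n + 1), (φ k * J.diffExpr ψ k - ψ k * J.diffExpr φ k) := by
  induction n with
  | zero => simp [wronskian_zero]
  | succ n ih => rw [wronskian_succ, ih, Finset.sum_range_succ _ (n + 1)]

/-- The Plücker relation for four vectors in the plane. With v, w two boundary sequences of constant
Wronskian, it expresses the boundary form of f and h through their boundary values. -/
theorem wronskian_plucker (f h v w : ℕ → ℂ) (n : ℕ) :
    J.wronskian f h n * J.wronskian v w n =
      J.wronskian v f n * J.wronskian w h n - J.wronskian w f n * J.wronskian v h n := by
  simp only [wronskian]; ring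

theorem wronskian_P_Q (z : ℂ) (n : ℕ) : J.wronskian (J.P z) (J.Q z) n = 1 := by
  induction n with
  | zero =>
    have := J.b_ne_zero 0
    simp only [wronskian, P, Q]
    field_simp
    ring
  | succ n ih =>
    rw [wronskian_succ, ih, diffExpr_P, diffExpr_Q]
    ring

theorem hasSum_inner_coe (f h : H) : HasSum (fun k => conj (f k) * h k) ⟪f, h⟫_ℂ := by
  have := lp.hasSum_inner (𝕜 := ℂ) (G := fun _ : ℕ => ℂ) f h
  simpa [mul_comm] using this

/-- The boundary form of the maximal operator is the limit of Wronskians. -/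
theorem tendsto_wronskian (f h : J.maximalOperator.domain) :
    Tendsto (J.wronskian (fun k => conj ((f : H) k)) (h : H)) atTop
      (𝓝 (⟪(f : H), J.maximalOperator h⟫_ℂ - ⟪J.maximalOperator f, (h : H)⟫_ℂ)) := by
  have h1 := (hasSum_inner_coe (f : H) (J.maximalOperator h)).sub
    (hasSum_inner_coe (J.maximalOperator f) (h : H))
  refine ((tendsto_add_atTop_iff_nat 1).2 h1.tendsto_sum_nat).congr fun n => ?_
  rw [wronskian_eq_sum]
  refine Finset.sum_congr rfl fun k _ => ?_
  rw [diffExpr_conj, maximalOperator_apply, maximalOperator_apply]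
  ring

/-! ### The adjoint of the Jacobi operator -/

/-- Summation by parts: the Wronskian vanishes beyond the support of x, so `f` may be any sequence.
-/
theorem tendsto_sum_mul_diffExpr_of_mem_finSeq (f : ℕ → ℂ) {x : H} (hx : x ∈ finSeq) {s : ℂ}
    (hs : HasSum (fun k => f k * J.diffExpr x k) s) :
    Tendsto (fun n => ∑ k ∈ Finset.range n, x k * J.diffExpr f k) atTop (𝓝 s) := by
  obtain ⟨N, hN⟩ := Set.Finite.bddAbove hx
  have h0 : ∀ k, N < k → x k = 0 := fun k hk => by
    by_contra h
    exact absurd (hN h) (by omega)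
  rw [← tendsto_add_atTop_iff_nat 1]
  refine ((tendsto_add_atTop_iff_nat 1).2 hs.tendsto_sum_nat).congr' ?_
  filter_upwards [eventually_gt_atTop N] with n hn
  have h1 := J.wronskian_eq_sum f x n
  rw [Finset.sum_sub_distrib] at h1
  rw [wronskian, h0 n hn, h0 (n + 1) (by omega)] at h1
  simp only [mul_zero, zero_mul, sub_zero] at h1
  linear_combination -h1

theorem single_mem_finSeq (k : ℕ) : (lp.single 2 k 1 : H) ∈ finSeq := by
  refine (Set.finite_singleton k).subset fun i hi => ?_
  by_contra h
  exact hi (by rw [lp.single_apply]; exact Pi.single_eq_of_ne h _)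

theorem inner_single (w : H) (k : ℕ) : ⟪w, lp.single 2 k 1⟫_ℂ = conj (w k) := by
  rw [lp.inner_single_right]; simp

theorem dense_finSeq : Dense (finSeq : Set H) := by
  rw [Submodule.dense_iff_topologicalClosure_eq_top, Submodule.topologicalClosure_eq_top_iff,
    Submodule.eq_bot_iff]
  intro x hx
  refine lp.ext (funext fun k => ?_)
  have := (Submodule.mem_orthogonal' _ _).1 hx _ (single_mem_finSeq k)
  rw [inner_single] at this
  simpa using this

theorem diffExpr_eq_of_inner {y w : H}
    (h : ∀ x : J.preOperator.domain, ⟪w, (x : H)⟫_ℂ = ⟪y, J.preOperator x⟫_ℂ) :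
    J.diffExpr y = w := by
  funext k
  have h1 := h ⟨_, single_mem_finSeq k⟩
  have h2 := J.tendsto_sum_mul_diffExpr_of_mem_finSeq (fun i => conj (y i)) (single_mem_finSeq k)
    (hasSum_inner_coe y (J.preOperator ⟨_, single_mem_finSeq k⟩))
  rw [← h1] at h2
  dsimp only at h2
  rw [inner_single] at h2
  have h3 : Tendsto (fun n => ∑ i ∈ Finset.range n,
      (lp.single 2 k (1 : ℂ) : H) i * J.diffExpr (fun i => conj (y i)) i) atTop
      (𝓝 (conj (J.diffExpr y k))) := by
    refine tendsto_const_nhds.congr' ?_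
    filter_upwards [eventually_gt_atTop k] with n hn
    rw [Finset.sum_eq_single_of_mem k (Finset.mem_range.2 hn)]
    · rw [lp.single_apply_self, one_mul, diffExpr_conj]
    · intro i _ hi
      rw [lp.single_apply, Pi.single_eq_of_ne hi, zero_mul]
  exact (starRingEnd ℂ).injective (tendsto_nhds_unique h3 h2)

theorem preOperator_isFormalAdjoint : J.preOperator.IsFormalAdjoint J.maximalOperator := by
  refine LinearPMap.IsFormalAdjoint.symm fun y x => ?_
  have h2 := J.tendsto_sum_mul_diffExpr_of_mem_finSeq (fun i => conj ((y : H) i)) x.2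
    (hasSum_inner_coe (y : H) (J.preOperator x))
  refine tendsto_nhds_unique ?_ h2
  refine (hasSum_inner_coe (J.maximalOperator y) (x : H)).tendsto_sum_nat.congr fun n => ?_
  refine Finset.sum_congr rfl fun k _ => ?_
  rw [diffExpr_conj, maximalOperator_apply, mul_comm]

/-- Testing against unit vectors shows that an adjoint acts by γ. The general T serves twice: for
the operator on finite sequences, where it yields that the maximal operator is closed, and then for
its closure J. -/
theorem adjoint_eq_maximalOperator {T : H →ₗ.[ℂ] H} (hle : J.preOperator ≤ T)
    (hT : T.IsFormalAdjoint J.maximalOperator) : T.adjoint = J.maximalOperator := by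
  have hd : Dense (T.domain : Set H) := dense_finSeq.mono hle.1
  have key : ∀ y : T.adjoint.domain, J.diffExpr (y : H) = T.adjoint y := fun y =>
    J.diffExpr_eq_of_inner fun x => by
      rw [hle.2 (y := ⟨x, hle.1 x.2⟩) rfl]
      exact LinearPMap.adjoint_isFormalAdjoint hd y ⟨x, hle.1 x.2⟩
  refine le_antisymm (show T.adjoint ≤ J.maximalOperator from ?_) (hT.le_adjoint hd)
  refine ⟨fun y hy => ?_, fun y y' hyy' => ?_⟩
  · exact (J.mem_maximalOperator_domain_of_eq (key ⟨y, hy⟩)).1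
  · obtain ⟨h1, h2⟩ := J.mem_maximalOperator_domain_of_eq (key y)
    rw [← h2]
    congr 1
    exact Subtype.ext hyy'

theorem maximalOperator_isClosed : J.maximalOperator.IsClosed := by
  rw [← J.adjoint_eq_maximalOperator le_rfl J.preOperator_isFormalAdjoint]
  exact LinearPMap.adjoint_isClosed dense_finSeq

theorem preOperator_le_maximalOperator : J.preOperator ≤ J.maximalOperator := by
  refine ⟨fun x hx => J.memℓp_diffExpr_of_finite hx, fun x y hxy => ?_⟩
  refine lp.ext ?_
  change J.diffExpr (x : H) = J.diffExpr (y : H)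
  rw [hxy]

theorem preOperator_isClosable : J.preOperator.IsClosable :=
  J.maximalOperator_isClosed.isClosable.leIsClosable J.preOperator_le_maximalOperator

theorem graph_operator : J.operator.graph = J.preOperator.graph.topologicalClosure :=
  J.preOperator_isClosable.graph_closure_eq_closure_graph.symm

theorem operator_le_maximalOperator : J.operator ≤ J.maximalOperator := by
  refine LinearPMap.le_of_le_graph ?_
  rw [graph_operator]
  exact Submodule.topologicalClosure_minimal _
    (LinearPMap.le_graph_of_le J.preOperator_le_maximalOperator) J.maximalOperator_isClosed

theorem operator_isFormalAdjoint : J.operator.IsFormalAdjoint J.maximalOperator := by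
  intro x y
  have hx : ((x : H), J.operator x) ∈ closure (J.preOperator.graph : Set (H × H)) := by
    rw [← Submodule.topologicalClosure_coe, ← graph_operator]
    exact J.operator.mem_graph x
  have hcl : IsClosed {p : H × H | ⟪p.2, (y : H)⟫_ℂ = ⟪p.1, J.maximalOperator y⟫_ℂ} :=
    isClosed_eq (by fun_prop) (by fun_prop)
  refine closure_minimal ?_ hcl hx
  rintro ⟨a, b⟩ hab
  obtain ⟨a', rfl, rfl⟩ := (LinearPMap.mem_graph_iff _).1 hab
  exact J.preOperator_isFormalAdjoint a' y

theorem adjoint_operator : J.operator.adjoint = J.maximalOperator :=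
  J.adjoint_eq_maximalOperator J.preOperator.le_closure J.operator_isFormalAdjoint

theorem isSelfAdjoint_operator_iff :
    IsSelfAdjoint J.operator ↔ J.maximalOperator = J.operator := by
  rw [LinearPMap.isSelfAdjoint_def, adjoint_operator]

end JacobiMatrix

/-! ### Square summability criteria -/

theorem memℓp_two_iff {f : ℕ → ℂ} : Memℓp f 2 ↔ Summable fun k => ‖f k‖ ^ 2 := by
  rw [memℓp_gen_iff (by norm_num)]
  simp

theorem memℓp_two_of_norm_le {f g : ℕ → ℂ} {C : ℝ} (hg : Memℓp g 2)
    (h : ∀ k, ‖f k‖ ≤ C * ‖g k‖) : Memℓp f 2 := by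
  rw [memℓp_two_iff] at hg ⊢
  refine Summable.of_nonneg_of_le (fun k => by positivity) (fun k => ?_) (hg.mul_left (C ^ 2))
  rw [← mul_pow]
  exact pow_le_pow_left₀ (norm_nonneg _) (h k) 2

namespace JacobiMatrix

variable (J : JacobiMatrix)

/-! ### Deficiency -/

theorem operator_isFormalAdjoint_self : J.operator.IsFormalAdjoint J.operator := by
  intro x y
  rw [J.operator_isFormalAdjoint x ⟨y, J.operator_le_maximalOperator.1 y.2⟩,
    J.operator_le_maximalOperator.2 (x := y) (y := ⟨y, J.operator_le_maximalOperator.1 y.2⟩) rfl]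

theorem eq_zero_of_not_memℓp_P {z : ℂ} (hP : ¬ Memℓp (J.P z) 2) {y : H}
    (hy : ∀ k, J.diffExpr y k = z * y k) : y = 0 := by
  have h := J.eq_smul_P hy
  rcases eq_or_ne (y 0) 0 with h0 | h0
  · rw [h0, zero_smul] at h
    exact lp.ext h
  · refine absurd ?_ hP
    have h1 : J.P z = (y 0)⁻¹ • (y : ℕ → ℂ) := by
      rw [eq_inv_smul_iff₀ h0]
      exact h.symm
    rw [h1]
    exact (lp.memℓp y).const_smul _

/-- The map `(f, J f) ↦ J f - i f` on the graph of the Jacobi operator. -/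
def graphSubI : J.operator.graph →L[ℂ] H :=
  (ContinuousLinearMap.snd ℂ H H - Complex.I • ContinuousLinearMap.fst ℂ H H).comp
    J.operator.graph.subtypeL

/-- Symmetry gives ‖x‖ ≤ ‖(J - i)x‖, hence ‖Jx‖ ≤ 2‖(J - i)x‖: the map is bounded below on the
complete graph. -/
theorem isClosed_range_graphSubI : IsClosed (Set.range J.graphSubI) := by
  have hcl : IsClosed (J.operator.graph : Set (H × H)) := by
    rw [graph_operator]
    exact Submodule.isClosed_topologicalClosure _
  have : CompleteSpace J.operator.graph := hcl.completeSpace_coe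
  have hb : ∀ p : J.operator.graph, ‖p‖ ≤ (2 : NNReal) * ‖J.graphSubI p‖ := by
    rintro ⟨⟨a, b⟩, hp⟩
    obtain ⟨x, rfl, rfl⟩ := (LinearPMap.mem_graph_iff _).1 hp
    have h1 := im_inner_sub_smul J.operator_isFormalAdjoint_self Complex.I x
    have h2 : J.graphSubI ⟨((x : H), J.operator x), hp⟩ = J.operator x - Complex.I • (x : H) := rfl
    rw [h2]
    have h3 := (Complex.abs_im_le_norm _).trans
      (norm_inner_le_norm (𝕜 := ℂ) (J.operator x - Complex.I • (x : H)) (x : H))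
    rw [h1, Complex.I_im, one_mul, abs_of_nonneg (by positivity), sq] at h3
    have h4 : ‖(x : H)‖ ≤ ‖J.operator x - Complex.I • (x : H)‖ := by
      rcases (norm_nonneg (x : H)).eq_or_lt' with h0 | h0
      · rw [h0]; positivity
      · exact le_of_mul_le_mul_right h3 h0
    have h5 : ‖J.operator x‖ ≤ ‖J.operator x - Complex.I • (x : H)‖ + ‖(x : H)‖ := by
      have := norm_add_le (J.operator x - Complex.I • (x : H)) (Complex.I • (x : H))
      rwa [sub_add_cancel, norm_smul, Complex.norm_I, one_mul] at this
    have h6 : ‖(⟨((x : H), J.operator x), hp⟩ : J.operator.graph)‖ =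
      max ‖(x : H)‖ ‖J.operator x‖ := rfl
    rw [h6]
    have := norm_nonneg (x : H)
    refine max_le ?_ ?_ <;> push_cast <;> linarith
  exact (J.graphSubI.antilipschitz_of_bound hb).isClosed_range J.graphSubI.uniformContinuous

theorem memℓp_P_conj {z : ℂ} (h : Memℓp (J.P z) 2) : Memℓp (J.P (conj z)) 2 := by
  rw [P_conj]
  exact memℓp_two_of_norm_le (C := 1) h fun k => by simp

/-- A vector orthogonal to the range solves γy = -iy, so it is a multiple of P(-i) = conj P(i) and
must vanish; the range is dense and closed. -/
theorem range_graphSubI (hP : ¬ Memℓp (J.P Complex.I) 2) : Set.range J.graphSubI = Set.univ := by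
  have hd : J.graphSubI.range.topologicalClosure = ⊤ := by
    rw [Submodule.topologicalClosure_eq_top_iff, Submodule.eq_bot_iff]
    intro y hy
    refine J.eq_zero_of_not_memℓp_P (z := conj Complex.I)
      (fun h => hP (by simpa using J.memℓp_P_conj h)) fun k => ?_
    have h1 : J.diffExpr y = (conj Complex.I • y : H) := J.diffExpr_eq_of_inner fun x => by
      have h2 := (Submodule.mem_orthogonal' _ _).1 hy (J.graphSubI
        ⟨((x : H), J.preOperator x), LinearPMap.le_graph_of_le J.preOperator.le_closure
          (J.preOperator.mem_graph x)⟩) ⟨_, rfl⟩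
      have h3 : ⟪y, J.preOperator x - Complex.I • (x : H)⟫_ℂ = 0 := h2
      rw [inner_sub_right, inner_smul_right, sub_eq_zero] at h3
      rw [inner_smul_left, h3, Complex.conj_conj]
    rw [h1]
    rfl
  have h1 : (J.graphSubI.range : Set H) = Set.range J.graphSubI := rfl
  rw [← h1, ← (h1 ▸ J.isClosed_range_graphSubI : IsClosed (J.graphSubI.range : Set H)).closure_eq,
    ← Submodule.topologicalClosure_coe, hd]
  rfl

/-- Von Neumann's argument: for f in the maximal domain pick x in dom J with (J - i)x = (J* - i)f.
Then x - f is a square summable solution at i, hence 0. -/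
theorem isSelfAdjoint_of_not_memℓp_P (hP : ¬ Memℓp (J.P Complex.I) 2) :
    IsSelfAdjoint J.operator := by
  rw [isSelfAdjoint_operator_iff]
  refine le_antisymm (LinearPMap.le_of_le_graph ?_) J.operator_le_maximalOperator
  rintro ⟨a, b⟩ hp
  obtain ⟨f, rfl, rfl⟩ := (LinearPMap.mem_graph_iff _).1 hp
  obtain ⟨⟨⟨a, b⟩, hab⟩, h1⟩ : J.maximalOperator f - Complex.I • (f : H) ∈ Set.range J.graphSubI := by
    rw [J.range_graphSubI hP]; trivial
  have h2 := LinearPMap.le_graph_of_le J.operator_le_maximalOperator hab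
  obtain ⟨x, rfl, rfl⟩ := (LinearPMap.mem_graph_iff _).1 h2
  have h3 : J.maximalOperator x - Complex.I • (x : H) =
    J.maximalOperator f - Complex.I • (f : H) := h1
  have h4 : x = f := by
    rw [← sub_eq_zero]
    refine Subtype.ext (J.eq_zero_of_not_memℓp_P hP (z := Complex.I) fun k => ?_)
    have h5 : J.maximalOperator (x - f) = Complex.I • ((x - f : J.maximalOperator.domain) : H) := by
      rw [LinearPMap.map_sub, AddSubgroupClass.coe_sub, smul_sub]
      rw [sub_eq_sub_iff_sub_eq_sub]
      exact h3
    exact congrFun (congrArg (fun u : H => (u : ℕ → ℂ)) h5) k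
  rwa [← h4]

/-! ### The limit circle case -/

/-- Green's formula gives the value 2i ∑ |P_k(i)|², and the term k = 0 is 1. -/
theorem one_le_norm_wronskian_P (n : ℕ) :
    1 ≤ ‖J.wronskian (fun k => conj (J.P Complex.I k)) (J.P Complex.I) n‖ := by
  have h : J.wronskian (fun k => conj (J.P Complex.I k)) (J.P Complex.I) n =
      2 * Complex.I * ((∑ k ∈ Finset.range (n + 1), ‖J.P Complex.I k‖ ^ 2 : ℝ) : ℂ) := by
    rw [wronskian_eq_sum, Complex.ofReal_sum, Finset.mul_sum]
    refine Finset.sum_congr rfl fun k _ => ?_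
    rw [diffExpr_conj, diffExpr_P, map_mul, Complex.conj_I, Complex.ofReal_pow,
      ← Complex.conj_mul']
    ring
  rw [h, norm_mul, Complex.norm_real, norm_mul, Complex.norm_I, Real.norm_of_nonneg (by positivity)]
  have h1 : ‖J.P Complex.I 0‖ ^ 2 ≤ ∑ k ∈ Finset.range (n + 1), ‖J.P Complex.I k‖ ^ 2 :=
    Finset.single_le_sum (f := fun k => ‖J.P Complex.I k‖ ^ 2) (fun _ _ => by positivity) (by simp)
  have h2 : ‖J.P Complex.I 0‖ ^ 2 = 1 := by simp [P]
  rw [h2] at h1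
  simp only [Complex.norm_ofNat, mul_one]
  linarith

/-- If the solution `P(i)` is square summable, so are all solutions at `0`. -/
theorem memℓp_of_diffExpr_eq_zero (hP : Memℓp (J.P Complex.I) 2) {y : ℕ → ℂ}
    (hy : ∀ k, J.diffExpr y (k + 1) = 0) : Memℓp y 2 := by
  set p := J.P Complex.I with hp
  set s : ℕ → ℝ := fun n => ‖J.wronskian (fun k => conj (p k)) y n‖ + ‖J.wronskian p y n‖
  -- Variation of constants: y is a combination of p and conj p, with Wronskians as coefficients.
  have hrep : ∀ n, ‖y (n + 1)‖ ≤ s n * ‖p (n + 1)‖ := by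
    intro n
    have h1 : y (n + 1) * J.wronskian (fun k => conj (p k)) p n =
        p (n + 1) * J.wronskian (fun k => conj (p k)) y n -
          conj (p (n + 1)) * J.wronskian p y n := by
      simp only [wronskian]; ring
    have h2 : ‖y (n + 1)‖ * 1 ≤ ‖y (n + 1) * J.wronskian (fun k => conj (p k)) p n‖ := by
      rw [norm_mul]
      exact mul_le_mul_of_nonneg_left (J.one_le_norm_wronskian_P n) (norm_nonneg _)
    rw [mul_one, h1] at h2
    refine h2.trans ((norm_sub_le _ _).trans (le_of_eq ?_))
    simp only [norm_mul, RCLike.norm_conj, s]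
    ring
  -- A discrete Gronwall inequality: each Wronskian grows by at most |y p| ≤ s |p|², and ∑ |p|²
  -- converges.
  have hstep : ∀ n, s (n + 1) ≤ s n * Real.exp (2 * ‖p (n + 1)‖ ^ 2) := by
    intro n
    have h1 : ‖J.wronskian (fun k => conj (p k)) y (n + 1)‖ ≤
        ‖J.wronskian (fun k => conj (p k)) y n‖ + ‖y (n + 1)‖ * ‖p (n + 1)‖ := by
      rw [wronskian_succ]
      refine (norm_add_le _ _).trans (add_le_add le_rfl (le_of_eq ?_))
      rw [diffExpr_conj, hy, hp, diffExpr_P]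
      simp
    have h2 : ‖J.wronskian p y (n + 1)‖ ≤
        ‖J.wronskian p y n‖ + ‖y (n + 1)‖ * ‖p (n + 1)‖ := by
      rw [wronskian_succ]
      refine (norm_add_le _ _).trans (add_le_add le_rfl (le_of_eq ?_))
      rw [hy, hp, diffExpr_P]
      simp
    have h3 := mul_le_mul_of_nonneg_right (hrep n) (norm_nonneg (p (n + 1)))
    have h4 : 0 ≤ s n := by positivity
    have h5 := mul_le_mul_of_nonneg_left (Real.add_one_le_exp (2 * ‖p (n + 1)‖ ^ 2)) h4
    refine le_trans ?_ h5
    simp only [s] at h3 ⊢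
    linarith
  have hsum := memℓp_two_iff.1 hP
  have hs : ∀ n, s n ≤ s 0 * Real.exp (2 * ∑ k ∈ Finset.range (n + 1), ‖p k‖ ^ 2) := by
    intro n
    have h0 : 0 ≤ s 0 := by positivity
    induction n with
    | zero =>
      refine le_mul_of_one_le_right h0 (Real.one_le_exp (by positivity))
    | succ n ih =>
      refine (hstep n).trans ?_
      rw [Finset.sum_range_succ _ (n + 1), mul_add, Real.exp_add, ← mul_assoc]
      exact mul_le_mul_of_nonneg_right ih (Real.exp_pos _).le
  set C := s 0 * Real.exp (2 * ∑' k, ‖p k‖ ^ 2)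
  have hC : ∀ n, s n ≤ C := fun n => (hs n).trans (by
    have h0 : 0 ≤ s 0 := by positivity
    have := hsum.sum_le_tsum (Finset.range (n + 1)) fun _ _ => by positivity
    exact mul_le_mul_of_nonneg_left (Real.exp_le_exp.2 (by linarith)) h0)
  refine memℓp_two_of_norm_le (C := max C ‖y 0‖) hP fun k => ?_
  cases k with
  | zero => simp [hp, P]
  | succ k =>
    refine (hrep k).trans (mul_le_mul_of_nonneg_right ?_ (norm_nonneg _))
    exact (hC k).trans (le_max_left _ _)

theorem memℓp_P_I (h : ¬ IsSelfAdjoint J.operator) : Memℓp (J.P Complex.I) 2 := by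
  by_contra hP
  exact h (J.isSelfAdjoint_of_not_memℓp_P hP)

/-! ### Boundary conditions at infinity -/

theorem conj_P_zero (k : ℕ) : conj (J.P 0 k) = J.P 0 k := by
  have := congrFun (J.P_conj 0) k
  rw [map_zero] at this
  exact this.symm

theorem conj_Q_zero (k : ℕ) : conj (J.Q 0 k) = J.Q 0 k := by
  have h := J.eq_zero_of_diffExpr_eq (z := 0)
    (f := (fun k => conj (J.Q 0 k)) + (-1 : ℂ) • J.Q 0) (fun k => by
      rw [diffExpr_add, diffExpr_smul]
      simp only [Pi.add_apply, Pi.smul_apply, diffExpr_conj, zero_mul]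
      cases k with
      | zero => simp [diffExpr, Q]
      | succ k => simp [diffExpr_Q]) (by simp [Q])
  have := congrFun h k
  simp only [Pi.add_apply, Pi.smul_apply, smul_eq_mul, Pi.zero_apply] at this
  linear_combination this

theorem conj_boundarySeq (g : WithTop ℝ) (k : ℕ) :
    conj (J.boundarySeq g k) = J.boundarySeq g k := by
  cases g with
  | top => exact J.conj_Q_zero k
  | coe g =>
    change conj (J.P 0 k + (g : ℂ) * J.Q 0 k) = J.P 0 k + (g : ℂ) * J.Q 0 k
    rw [map_add, map_mul, conj_P_zero, conj_Q_zero, Complex.conj_ofReal]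

theorem diffExpr_boundarySeq (g : WithTop ℝ) (k : ℕ) :
    J.diffExpr (J.boundarySeq g) (k + 1) = 0 := by
  cases g with
  | top =>
    change J.diffExpr (J.Q 0) (k + 1) = 0
    rw [diffExpr_Q, zero_mul]
  | coe g =>
    change J.diffExpr (J.P 0 + (g : ℂ) • J.Q 0) (k + 1) = 0
    rw [diffExpr_add, diffExpr_smul]
    simp [diffExpr_P, diffExpr_Q]

theorem wronskian_boundarySeq {g g' : WithTop ℝ} (h : g ≠ g') :
    ∃ c : ℂ, c ≠ 0 ∧ ∀ n, J.wronskian (J.boundarySeq g) (J.boundarySeq g') n = c := by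
  cases g with
  | top =>
    cases g' with
    | top => exact absurd rfl h
    | coe g' =>
      refine ⟨-1, by norm_num, fun n => ?_⟩
      have := J.wronskian_P_Q 0 n
      simp only [wronskian, boundarySeq] at this ⊢
      linear_combination -this
  | coe g =>
    cases g' with
    | top =>
      refine ⟨1, by norm_num, fun n => ?_⟩
      have := J.wronskian_P_Q 0 n
      simp only [wronskian, boundarySeq] at this ⊢
      linear_combination this
    | coe g' =>
      refine ⟨g' - g, ?_, fun n => ?_⟩
      · rw [sub_ne_zero]
        intro h1
        exact h (by rw [Complex.ofReal_injective h1])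
      · have := J.wronskian_P_Q 0 n
        simp only [wronskian, boundarySeq] at this ⊢
        linear_combination ((g' : ℂ) - g) * this

/-- In the limit circle case v(g) is square summable and γv(g) vanishes beyond its first entry, so
v(g) is real and in the maximal domain, where boundary forms converge. -/
theorem exists_tendsto_wronskian_boundarySeq (hJ : ¬ IsSelfAdjoint J.operator) (g : WithTop ℝ)
    (h : J.maximalOperator.domain) :
    ∃ l, Tendsto (J.wronskian (J.boundarySeq g) (h : H)) atTop (𝓝 l) := by
  have h1 := J.memℓp_of_diffExpr_eq_zero (J.memℓp_P_I hJ) (J.diffExpr_boundarySeq g)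
  have h2 : (⟨J.boundarySeq g, h1⟩ : H) ∈ J.maximalOperator.domain := by
    refine (memℓp_zero ((Set.finite_singleton 0).subset fun k hk => ?_) :
      Memℓp (J.diffExpr (J.boundarySeq g)) 0).of_exponent_ge (by simp)
    cases k with
    | zero => rfl
    | succ k => exact absurd (J.diffExpr_boundarySeq g k) hk
  have h3 := J.tendsto_wronskian ⟨_, h2⟩ h
  have h4 : (fun k => conj ((⟨J.boundarySeq g, h1⟩ : H) k)) = J.boundarySeq g :=
    funext fun k => J.conj_boundarySeq g k
  rw [h4] at h3
  exact ⟨_, h3⟩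

theorem wronskian_boundarySeq_conj (g : WithTop ℝ) (f : ℕ → ℂ) (n : ℕ) :
    J.wronskian (J.boundarySeq g) (fun k => conj (f k)) n =
      conj (J.wronskian (J.boundarySeq g) f n) := by
  simp only [wronskian, map_mul, map_sub, conj_boundarySeq, Complex.conj_ofReal]

/-- Two sequences in the maximal domain such that the first satisfies two different boundary
conditions, or both satisfy the same, have Wronskian tending to zero. -/
theorem tendsto_wronskian_zero {g g' : WithTop ℝ} (hg : g ≠ g') {f h : ℕ → ℂ}
    (h1 : Tendsto (fun n => J.wronskian (J.boundarySeq g) f n * J.wronskian (J.boundarySeq g') h n)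
      atTop (𝓝 0))
    (h2 : Tendsto (fun n => J.wronskian (J.boundarySeq g') f n * J.wronskian (J.boundarySeq g) h n)
      atTop (𝓝 0)) :
    Tendsto (J.wronskian f h) atTop (𝓝 0) := by
  obtain ⟨c, hc, hc'⟩ := J.wronskian_boundarySeq hg
  have := (h1.sub h2).mul_const c⁻¹
  rw [sub_zero, zero_mul] at this
  refine this.congr fun n => ?_
  rw [← wronskian_plucker, hc', mul_assoc, mul_inv_cancel₀ hc, mul_one]

/-! ### Restrictions of the maximal operator and symmetry of J(g) -/

/-- The restriction of the maximal operator to a subspace. -/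
def restrictedOperator (D : Submodule ℂ H) : H →ₗ.[ℂ] H := J.maximalOperator.domRestrict D

open Classical in
/-- The boundary condition at infinity of the operator `J(g)`, which is void if `J = J*`. -/
def effectiveCondition (g : WithTop ℝ) : Submodule ℂ H :=
  if IsSelfAdjoint J.operator then ⊤ else J.boundaryCondition g

theorem domRestrict_top (T : H →ₗ.[ℂ] H) : T.domRestrict ⊤ = T := by
  refine le_antisymm LinearPMap.domRestrict_le ⟨fun x hx => ⟨trivial, hx⟩, fun x y hxy => ?_⟩
  exact (LinearPMap.domRestrict_apply (x := y) (y := x) hxy.symm).symm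

theorem dirichletOperator_eq (g : WithTop ℝ) :
    J.dirichletOperator g = J.restrictedOperator (J.effectiveCondition g) := by
  unfold dirichletOperator effectiveCondition restrictedOperator
  split_ifs with h
  · rw [domRestrict_top, J.isSelfAdjoint_operator_iff.1 h]
  · rw [adjoint_operator]

theorem dirichletOperator_isFormalAdjoint (g : WithTop ℝ) :
    (J.dirichletOperator g).IsFormalAdjoint (J.dirichletOperator g) := by
  by_cases hJ : IsSelfAdjoint J.operator
  · unfold dirichletOperator
    rw [if_pos hJ]
    exact J.operator_isFormalAdjoint_self
  · unfold dirichletOperator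
    rw [if_neg hJ, adjoint_operator]
    intro f h
    have hf : Tendsto (J.wronskian (J.boundarySeq g) (f : H)) atTop (𝓝 0) := f.2.1
    have hh : Tendsto (J.wronskian (J.boundarySeq g) (h : H)) atTop (𝓝 0) := h.2.1
    -- An auxiliary second condition for the Plücker relation: in each product one factor tends to 0
    -- by condition g, and the other merely converges.
    obtain ⟨g', hg⟩ : ∃ g' : WithTop ℝ, g ≠ g' := by
      obtain ⟨g', hg'⟩ := exists_ne g
      exact ⟨g', hg'.symm⟩
    obtain ⟨l, hl⟩ := J.exists_tendsto_wronskian_boundarySeq hJ g' ⟨f, f.2.2⟩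
    obtain ⟨l', hl'⟩ := J.exists_tendsto_wronskian_boundarySeq hJ g' ⟨h, h.2.2⟩
    have hlim := J.tendsto_wronskian ⟨f, f.2.2⟩ ⟨h, h.2.2⟩
    have h0 : Tendsto (J.wronskian (fun k => conj ((f : H) k)) (h : H)) atTop (𝓝 0) := by
      refine J.tendsto_wronskian_zero hg ?_ ?_
      · simp only [wronskian_boundarySeq_conj]
        have := ((Complex.continuous_conj.tendsto _).comp hf).mul hl'
        simpa using this
      · simp only [wronskian_boundarySeq_conj]
        have := ((Complex.continuous_conj.tendsto _).comp hl).mul hh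
        simpa using this
    have := tendsto_nhds_unique hlim h0
    exact (sub_eq_zero.1 this).symm

end JacobiMatrix

theorem coe_add_apply (f g : H) (k : ℕ) : (f + g : H) k = f k + g k := rfl

theorem coe_smul_apply (c : ℂ) (f : H) (k : ℕ) : (c • f : H) k = c * f k := rfl

/-! ### Shifts -/

theorem hasSum_norm_sq (f : H) : HasSum (fun k => ‖f k‖ ^ 2) (‖f‖ ^ 2) := by
  have := JacobiMatrix.hasSum_inner_coe f f
  rw [inner_self_eq_norm_sq_to_K] at this
  simp only [Complex.conj_mul'] at this
  refine Complex.hasSum_ofReal.1 ?_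
  convert this using 2 <;> exact Complex.ofReal_pow _ _

theorem memℓp_consZero (f : H) : Memℓp (JacobiMatrix.consZero f) 2 := by
  rw [memℓp_two_iff, ← summable_nat_add_iff 1]
  exact memℓp_two_iff.1 (lp.memℓp f)

theorem memℓp_succ (f : H) : Memℓp (fun k => f (k + 1)) 2 := by
  have := memℓp_two_iff.1 (lp.memℓp f)
  rw [memℓp_two_iff]
  exact (summable_nat_add_iff 1).2 this

/-- The right shift `(f₀, f₁, …) ↦ (0, f₀, f₁, …)`. -/
def rightShift : H →ₗᵢ[ℂ] H where
  toFun f := ⟨JacobiMatrix.consZero f, memℓp_consZero f⟩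
  map_add' f g := by
    refine lp.ext (funext fun k => ?_)
    cases k with
    | zero => exact (add_zero (0 : ℂ)).symm
    | succ k => rfl
  map_smul' c f := by
    refine lp.ext (funext fun k => ?_)
    cases k <;> simp [JacobiMatrix.consZero]
  norm_map' f := by
    have h1 := hasSum_norm_sq ⟨JacobiMatrix.consZero f, memℓp_consZero f⟩
    have h2 := (hasSum_nat_add_iff' 1).2 h1
    have h3 := h2.unique (hasSum_norm_sq f)
    simp only [Finset.range_one, Finset.sum_singleton, JacobiMatrix.consZero, norm_zero,
      ne_eq, OfNat.ofNat_ne_zero, not_false_eq_true, zero_pow, sub_zero] at h3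
    exact (pow_left_inj₀ (norm_nonneg _) (norm_nonneg _) two_ne_zero).1 h3

/-- The left shift `(f₀, f₁, …) ↦ (f₁, f₂, …)`. -/
def leftShift : H →L[ℂ] H :=
  LinearMap.mkContinuous
    { toFun := fun f => ⟨fun k => f (k + 1), memℓp_succ f⟩
      map_add' := fun f g => rfl
      map_smul' := fun c f => rfl } 1 (fun f => by
    have h1 := hasSum_norm_sq ⟨fun k => f (k + 1), memℓp_succ f⟩
    have h2 := (hasSum_nat_add_iff' 1).2 (hasSum_norm_sq f)
    have h3 := h2.unique h1
    rw [one_mul, ← pow_le_pow_iff_left₀ (norm_nonneg _) (norm_nonneg _) two_ne_zero]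
    refine le_trans (le_of_eq h3.symm) ?_
    simp)

@[simp]
theorem rightShift_zero (f : H) : rightShift f 0 = 0 := rfl

@[simp]
theorem rightShift_succ (f : H) (k : ℕ) : rightShift f (k + 1) = f k := rfl

@[simp]
theorem leftShift_apply (f : H) (k : ℕ) : leftShift f k = f (k + 1) := rfl

@[simp]
theorem leftShift_rightShift (f : H) : leftShift (rightShift f) = f := rfl

@[simp]
theorem leftShift_e0 : leftShift e0 = 0 := lp.ext (funext fun k => by
  rw [leftShift_apply, e0_apply]; simp)

theorem smul_e0_add_rightShift (f : H) : f 0 • e0 + rightShift (leftShift f) = f := by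
  refine lp.ext (funext fun k => ?_)
  rw [coe_add_apply, coe_smul_apply, e0_apply]
  cases k <;> simp

namespace JacobiMatrix

variable (J : JacobiMatrix) (D : Submodule ℂ H)

/-! ### The inhomogeneous equation -/

/-- `f` satisfies the boundary condition `D` and `γ f - z f = x`. -/
def Solves (z : ℂ) (f x : H) : Prop := f ∈ D ∧ ∀ k, J.diffExpr f k = z * f k + x k

variable {J D} {z : ℂ} {f x : H}

theorem solves_iff : J.Solves D z f x ↔ ∃ h : f ∈ (J.restrictedOperator D).domain,
    J.restrictedOperator D ⟨f, h⟩ - z • f = x := by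
  constructor
  · rintro ⟨h1, h2⟩
    have h3 : J.diffExpr f = (z • f + x : H) := funext h2
    refine ⟨⟨h1, (J.mem_maximalOperator_domain_of_eq h3).1⟩, ?_⟩
    rw [sub_eq_iff_eq_add']
    exact lp.ext h3
  · rintro ⟨h1, h2⟩
    refine ⟨h1.1, fun k => ?_⟩
    rw [sub_eq_iff_eq_add'] at h2
    exact congrFun (congrArg (fun u : H => (u : ℕ → ℂ)) h2) k

theorem Solves.add {f' x' : H} (h : J.Solves D z f x) (h' : J.Solves D z f' x') :
    J.Solves D z (f + f') (x + x') := by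
  refine ⟨D.add_mem h.1 h'.1, fun k => ?_⟩
  rw [lp.coeFn_add, diffExpr_add]
  simp only [lp.coeFn_add, Pi.add_apply, h.2, h'.2]
  ring

theorem Solves.smul (h : J.Solves D z f x) (c : ℂ) : J.Solves D z (c • f) (c • x) := by
  refine ⟨D.smul_mem c h.1, fun k => ?_⟩
  rw [lp.coeFn_smul, diffExpr_smul]
  simp only [lp.coeFn_smul, Pi.smul_apply, smul_eq_mul, h.2]
  ring

theorem Solves.eq_zero (h : J.Solves D z f 0) (h0 : f 0 = 0) : f = 0 :=
  lp.ext (J.eq_zero_of_diffExpr_eq (fun k => by simpa using h.2 k) h0)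

theorem isResolvent_iff {R : H →L[ℂ] H} : IsResolvent (J.restrictedOperator D) z R ↔
    (∀ x, J.Solves D z (R x) x) ∧ ∀ f x, J.Solves D z f x → R x = f := by
  constructor
  · intro h
    refine ⟨fun x => solves_iff.2 (h.1 x), fun f x hf => ?_⟩
    obtain ⟨h1, rfl⟩ := solves_iff.1 hf
    exact h.2 ⟨f, h1⟩
  · rintro ⟨h1, h2⟩
    exact ⟨fun x => solves_iff.1 (h1 x), fun y => h2 _ _ (solves_iff.2 ⟨y.2, rfl⟩)⟩

theorem solves_resolvent (hz : z ∈ resolventSet (J.restrictedOperator D)) (x : H) :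
    J.Solves D z (resolvent (J.restrictedOperator D) z x) x :=
  (isResolvent_iff.1 (isResolvent_resolvent hz)).1 x

theorem Solves.eq_resolvent (hz : z ∈ resolventSet (J.restrictedOperator D))
    (h : J.Solves D z f x) : resolvent (J.restrictedOperator D) z x = f :=
  (isResolvent_iff.1 (isResolvent_resolvent hz)).2 f x h

theorem isResolvent_of_injective {R : H →L[ℂ] H} (h : ∀ x, J.Solves D z (R x) x)
    (hinj : ∀ f, J.Solves D z f 0 → f = 0) : IsResolvent (J.restrictedOperator D) z R := by
  refine isResolvent_iff.2 ⟨h, fun f x hf => ?_⟩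
  have := (h x).add (hf.smul (-1))
  rw [neg_one_smul, neg_one_smul, add_neg_cancel] at this
  rw [← sub_eq_zero, sub_eq_add_neg]
  exact hinj _ this

/-! ### Removing the first row and column -/

/-- The boundary condition of the matrix with the first row and column removed. -/
def tailCondition (D : Submodule ℂ H) : Submodule ℂ H := D.comap rightShift.toLinearMap

theorem mem_tailCondition : f ∈ tailCondition D ↔ rightShift f ∈ D := Iff.rfl

theorem e0_mem_finSeq : e0 ∈ finSeq := single_mem_finSeq 0

theorem leftShift_mem_tailCondition (hD : finSeq ≤ D) :
    leftShift f ∈ tailCondition D ↔ f ∈ D := by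
  rw [mem_tailCondition]
  conv_rhs => rw [← smul_e0_add_rightShift f]
  exact (D.add_mem_iff_right (D.smul_mem _ (hD e0_mem_finSeq))).symm

theorem finSeq_le_tailCondition (hD : finSeq ≤ D) : finSeq ≤ tailCondition D := by
  intro f hf
  rw [mem_tailCondition]
  refine hD ?_
  refine ((hf.image Nat.succ).subset fun k hk => ?_ :
    (Function.support ((rightShift f : H) : ℕ → ℂ)).Finite)
  cases k with
  | zero => exact absurd rfl hk
  | succ k => exact ⟨k, hk, rfl⟩

/-- The first row is split off; the coupling b₀f₀ of the second row to f₀ becomes part of the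
right-hand side of the truncated equation. -/
theorem solves_iff_tail (hD : finSeq ≤ D) : J.Solves D z f x ↔
    J.q 0 * f 0 + J.b 0 * f 1 = z * f 0 + x 0 ∧
      J.tail.Solves (tailCondition D) z (leftShift f) (leftShift x - (J.b 0 * f 0 : ℂ) • e0) := by
  have h0 : J.tail.diffExpr (leftShift f) 0 = J.diffExpr f 1 - J.b 0 * f 0 := by
    simp [diffExpr, tail]; ring
  have h1 : ∀ k, J.tail.diffExpr (leftShift f) (k + 1) = J.diffExpr f (k + 2) := fun k => rfl
  have h2 : (∀ k, J.tail.diffExpr (leftShift f) k = z * leftShift f k +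
      (leftShift x - (J.b 0 * f 0 : ℂ) • e0 : H) k) ↔
      ∀ k, J.diffExpr f (k + 1) = z * f (k + 1) + x (k + 1) := by
    refine forall_congr' fun k => ?_
    simp only [lp.coeFn_sub, lp.coeFn_smul, Pi.sub_apply, Pi.smul_apply, e0_apply, leftShift_apply,
      smul_eq_mul]
    cases k with
    | zero =>
      rw [h0, if_pos rfl, mul_one]
      constructor <;> intro h <;> linear_combination h
    | succ k => rw [h1, if_neg k.succ_ne_zero, mul_zero, sub_zero]
  rw [Solves, Solves, leftShift_mem_tailCondition hD, h2]
  constructor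
  · rintro ⟨h3, h4⟩
    exact ⟨h4 0, h3, fun k => h4 (k + 1)⟩
  · rintro ⟨h3, h4, h5⟩
    exact ⟨h4, fun k => by cases k with | zero => exact h3 | succ k => exact h5 k⟩

theorem Solves.rightShift (hD : finSeq ≤ D) (h : J.tail.Solves (tailCondition D) z f x) :
    J.Solves D z (rightShift f) (JacobiTwoSpectra.rightShift x + (J.b 0 * f 0 : ℂ) • e0) := by
  rw [solves_iff_tail hD]
  constructor
  · rw [show JacobiTwoSpectra.rightShift f 1 = f 0 from rfl]
    rw [coe_add_apply, coe_smul_apply, e0_apply]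
    simp
  · simpa using h

theorem Solves.leftShift (hD : finSeq ≤ D) {c : ℂ} (h0 : f 0 = 0)
    (h : J.Solves D z f (JacobiTwoSpectra.rightShift x + c • e0)) :
    J.tail.Solves (tailCondition D) z (leftShift f) x := by
  have := ((solves_iff_tail hD).1 h).2
  simpa [h0] using this

/-! ### Realizations and their Weyl functions under truncation -/

variable (J D) in
/-- The operator with boundary condition `D` is symmetric and its spectrum is real. -/
structure IsRealization : Prop where
  finSeq_le : finSeq ≤ D
  symmetric : (J.restrictedOperator D).IsFormalAdjoint (J.restrictedOperator D)
  mem_of_im_ne_zero : ∀ z : ℂ, z.im ≠ 0 → z ∈ resolventSet (J.restrictedOperator D)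

variable (J D) in
/-- The Weyl function of the realization of `J` with boundary condition `D`. -/
abbrev weylFn : ℂ → ℂ := weyl (J.restrictedOperator D)

variable (J D) in
/-- The reciprocal of the Weyl function, in terms of the truncated matrix. -/
def weylInv (z : ℂ) : ℂ := J.q 0 - z - J.b 0 ^ 2 * J.tail.weylFn (tailCondition D) z

theorem weylFn_eq : J.weylFn D z = resolvent (J.restrictedOperator D) z e0 0 := weyl_eq_apply

/-- The truncated equation gives f₁ = -b₀ f₀ m₁(z); inserting this in the first row is the Schur
complement. The case c = 1 yields the reciprocal of m, and c = 0 its vanishing at eigenvalues. -/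
theorem apply_zero_mul_weylInv (hD : finSeq ≤ D)
    (hz : z ∈ resolventSet (J.tail.restrictedOperator (tailCondition D))) {c : ℂ}
    (h : J.Solves D z f (c • e0)) : f 0 * J.weylInv D z = c := by
  obtain ⟨h1, h2⟩ := (solves_iff_tail hD).1 h
  have h3 := h2.eq_resolvent hz
  rw [map_smul, leftShift_e0, smul_zero, zero_sub, ← neg_smul, map_smul] at h3
  have h4 := congrFun (congrArg (fun u : H => (u : ℕ → ℂ)) h3) 0
  simp only [lp.coeFn_smul, Pi.smul_apply, smul_eq_mul, ← weylFn_eq, leftShift_apply,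
    zero_add] at h4
  simp only [e0_apply, lp.coeFn_smul, Pi.smul_apply, smul_eq_mul, if_true, mul_one] at h1
  rw [← h4] at h1
  rw [weylInv]
  linear_combination h1

theorem weylFn_mul_weylInv (hD : finSeq ≤ D)
    (hz : z ∈ resolventSet (J.restrictedOperator D))
    (hz' : z ∈ resolventSet (J.tail.restrictedOperator (tailCondition D))) :
    J.weylFn D z * J.weylInv D z = 1 := by
  have := solves_resolvent hz e0
  rw [← one_smul ℂ e0] at this
  have h2 := apply_zero_mul_weylInv hD hz' this
  rwa [one_smul, ← weylFn_eq] at h2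

theorem weylInv_eq_zero (hD : finSeq ≤ D)
    (hz' : z ∈ resolventSet (J.tail.restrictedOperator (tailCondition D)))
    (hf : J.Solves D z f 0) (hf0 : f ≠ 0) : J.weylInv D z = 0 := by
  rw [← zero_smul ℂ e0] at hf
  have h2 := apply_zero_mul_weylInv hD hz' hf
  rw [zero_smul] at hf
  exact (mul_eq_zero.1 h2).resolve_left fun h => hf0 (hf.eq_zero h)

/-- The truncated equation is the full one for vectors with first entry 0, the first row being left
free; the free row is the multiple of e₀. -/
theorem mem_resolventSet_tail (hD : finSeq ≤ D) (T : H →L[ℂ] H)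
    (hT0 : ∀ x, T x 0 = 0) (hT : ∀ x, ∃ c : ℂ, J.Solves D z (T x) (rightShift x + c • e0))
    (hinj : ∀ (f : H) (c : ℂ), f 0 = 0 → J.Solves D z f (c • e0) → f = 0) :
    z ∈ resolventSet (J.tail.restrictedOperator (tailCondition D)) := by
  refine (isResolvent_of_injective (R := leftShift.comp T) (fun x => ?_) fun f hf => ?_).mem
  · obtain ⟨c, hc⟩ := hT x
    exact hc.leftShift hD (hT0 x)
  · have h1 := hf.rightShift hD
    rw [map_zero, zero_add] at h1
    have := hinj _ _ rfl h1
    rw [← leftShift_rightShift f, this, map_zero]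

/-- A rank one correction: since (R e₀)₀ = m(z) ≠ 0, a multiple of R e₀ cancels the first entry at
the cost of a multiple of e₀ on the right. -/
theorem mem_resolventSet_tail_of_weylFn_ne_zero (hD : finSeq ≤ D)
    (hz : z ∈ resolventSet (J.restrictedOperator D)) (hm : J.weylFn D z ≠ 0) :
    z ∈ resolventSet (J.tail.restrictedOperator (tailCondition D)) := by
  set R := resolvent (J.restrictedOperator D) z
  have hRe : ⟪e0, R e0⟫_ℂ = J.weylFn D z := rfl
  let φ : H →L[ℂ] ℂ := (J.weylFn D z)⁻¹ • (innerSL ℂ e0).comp (R.comp rightShift.toContinuousLinearMap)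
  have hφ : ∀ x, φ x = (J.weylFn D z)⁻¹ * R (rightShift x) 0 := fun x => by
    rw [← inner_e0_left]; rfl
  let T : H →L[ℂ] H := R.comp rightShift.toContinuousLinearMap - φ.smulRight (R e0)
  have hT : ∀ x, T x = R (rightShift x) + (-φ x) • R e0 := fun x => by
    rw [neg_smul, ← sub_eq_add_neg]; rfl
  refine mem_resolventSet_tail hD T (fun x => ?_) (fun x => ⟨-φ x, ?_⟩) fun f c hf0 hf => ?_
  · rw [hT, hφ]
    simp only [lp.coeFn_add, lp.coeFn_smul, Pi.add_apply, Pi.smul_apply, smul_eq_mul]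
    rw [← weylFn_eq]
    field_simp
    ring
  · rw [hT]
    exact (solves_resolvent hz _).add ((solves_resolvent hz _).smul _)
  · have h1 := hf.eq_resolvent hz
    rw [map_smul] at h1
    have h2 : c * J.weylFn D z = 0 := by
      rw [weylFn_eq, ← hf0, ← h1]; rfl
    rw [← h1, (mul_eq_zero.1 h2).resolve_right hm, zero_smul]

/-- An eigenvector u has u₀ ≠ 0, so a multiple of e₀ moves any right-hand side into u^⊥, where the
reduced resolvent solves; a multiple of u then cancels the first entry. -/
theorem mem_resolventSet_tail_of_eigenvalue (h : J.IsRealization D)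
    (hacc : ¬ AccPt z (𝓟 (spectrum (J.restrictedOperator D)))) {u : H} (hu : J.Solves D z u 0)
    (hu0 : u ≠ 0) : z ∈ resolventSet (J.tail.restrictedOperator (tailCondition D)) := by
  have hr : z.im = 0 := by
    obtain ⟨h1, h2⟩ := solves_iff.1 hu
    exact eigenvalue_im_eq_zero h.symmetric (y := ⟨u, h1⟩) hu0 (sub_eq_zero.1 h2)
  obtain ⟨S, hS⟩ := exists_reduced_resolvent h.symmetric hr hacc
  wlog hu1 : u 0 = 1 generalizing u
  · have h1 : u 0 ≠ 0 := fun h => hu0 (hu.eq_zero h)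
    refine this (u := (u 0)⁻¹ • u) (by simpa using hu.smul (u 0)⁻¹)
      (smul_ne_zero (inv_ne_zero h1) hu0) ?_
    simp [h1]
  have horth : ∀ k : H, ⟪u, k⟫_ℂ = 0 → J.Solves D z (S k) k := by
    intro k hk
    refine solves_iff.2 (hS k fun v hv => ?_)
    have h1 : J.Solves D z v 0 := solves_iff.2 ⟨v.2, sub_eq_zero.2 hv⟩
    have h2 : (v : H) + (-(v : H) 0) • u = 0 := by
      have := h1.add (hu.smul (-(v : H) 0))
      rw [smul_zero, add_zero] at this
      refine this.eq_zero ?_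
      rw [coe_add_apply, coe_smul_apply, hu1]
      ring
    rw [neg_smul, ← sub_eq_add_neg, sub_eq_zero] at h2
    rw [h2, inner_smul_left, hk, mul_zero]
  let K : H →L[ℂ] H := rightShift.toContinuousLinearMap -
    ((innerSL ℂ u).comp rightShift.toContinuousLinearMap).smulRight e0
  have hK : ∀ x, K x = rightShift x + (-⟪u, rightShift x⟫_ℂ) • e0 := fun x => by
    rw [neg_smul, ← sub_eq_add_neg]; rfl
  have hKu : ∀ x, ⟪u, K x⟫_ℂ = 0 := fun x => by
    rw [hK, inner_add_right, inner_smul_right, inner_e0_right, hu1, map_one, mul_one,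
      add_neg_cancel]
  let T : H →L[ℂ] H := S.comp K - ((innerSL ℂ e0).comp (S.comp K)).smulRight u
  have hT : ∀ x, T x = S (K x) + (-(S (K x) 0)) • u := fun x => by
    rw [neg_smul, ← sub_eq_add_neg, ← inner_e0_left]; rfl
  refine mem_resolventSet_tail h.finSeq_le T (fun x => ?_)
    (fun x => ⟨-⟪u, rightShift x⟫_ℂ, ?_⟩) fun f c hf0 hf => ?_
  · rw [hT, coe_add_apply, coe_smul_apply, hu1]
    ring
  · rw [← hK, hT]
    simpa using (horth _ (hKu x)).add (hu.smul (-(S (K x) 0)))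
  · obtain ⟨h1, h2⟩ := solves_iff.1 hf
    obtain ⟨h3, h4⟩ := solves_iff.1 hu
    -- Pairing (J - z)f = c e₀ with the eigenvector u gives c = 0, as u₀ = 1.
    have h5 := h.symmetric ⟨u, h3⟩ ⟨f, h1⟩
    rw [sub_eq_iff_eq_add] at h2 h4
    rw [h2, h4, zero_add, inner_smul_left, inner_add_right, inner_smul_right, inner_smul_right,
      Complex.conj_eq_iff_im.2 hr, inner_e0_right, hu1, map_one, mul_one] at h5
    have hc : c = 0 := by linear_combination -h5
    rw [hc, zero_smul] at hf
    exact hf.eq_zero hf0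

/-- Symmetry is inherited through the right shift, since the extra multiples of e₀ are orthogonal to
its range. For nonreal z, Im m(z) ≠ 0, so m(z) ≠ 0 and the truncated resolvent exists. -/
theorem IsRealization.tail (h : J.IsRealization D) :
    J.tail.IsRealization (tailCondition D) where
  finSeq_le := finSeq_le_tailCondition h.finSeq_le
  symmetric := by
    have key : ∀ f : (J.tail.restrictedOperator (tailCondition D)).domain,
        ∃ h : rightShift (f : H) ∈ (J.restrictedOperator D).domain,
          J.restrictedOperator D ⟨_, h⟩ =
          rightShift (J.tail.restrictedOperator (tailCondition D) f) +
            (J.b 0 * (f : H) 0 : ℂ) • e0 := by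
      intro f
      have h1 : J.tail.Solves (tailCondition D) 0 (f : H)
        (J.tail.restrictedOperator (tailCondition D) f) := solves_iff.2 ⟨f.2, by simp⟩
      obtain ⟨h2, h3⟩ := solves_iff.1 (h1.rightShift h.finSeq_le)
      exact ⟨h2, by simpa using h3⟩
    intro f g
    obtain ⟨hf, hf'⟩ := key f
    obtain ⟨hg, hg'⟩ := key g
    have := h.symmetric ⟨_, hf⟩ ⟨_, hg⟩
    rw [hf', hg', inner_add_left, inner_add_right, inner_smul_left, inner_smul_right,
      inner_e0_left, inner_e0_right, LinearIsometry.inner_map_map,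
      LinearIsometry.inner_map_map] at this
    simpa using this
  mem_of_im_ne_zero z hz := by
    have h1 := h.mem_of_im_ne_zero z hz
    refine mem_resolventSet_tail_of_weylFn_ne_zero h.finSeq_le h1 fun h0 => ?_
    have h2 := im_weyl h.symmetric h1
    rw [show weyl (J.restrictedOperator D) z = 0 from h0, Complex.zero_im] at h2
    have h3 := norm_resolvent_e0_pos h1
    exact mul_ne_zero hz (pow_pos h3 2).ne' h2.symm

end JacobiMatrix

/-! ### Quotients of holomorphic functions with the same zeros and poles -/

/-- Near z₀, F is the quotient of the divided differences of a and b, which are holomorphic, and the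
denominator does not vanish at z₀. -/
theorem differentiableAt_div_of_simple_zero {a b F : ℂ → ℂ} {z₀ : ℂ}
    (ha : ∀ᶠ z in 𝓝 z₀, DifferentiableAt ℂ a z) (hb : ∀ᶠ z in 𝓝 z₀, DifferentiableAt ℂ b z)
    (ha0 : a z₀ = 0) (hb0 : b z₀ = 0) (hb' : deriv b z₀ ≠ 0)
    (hF : ∀ᶠ z in 𝓝[≠] z₀, F z = a z / b z) (hF0 : F z₀ = deriv a z₀ / deriv b z₀) :
    DifferentiableAt ℂ F z₀ := by
  have key : ∀ {f : ℂ → ℂ}, (∀ᶠ z in 𝓝 z₀, DifferentiableAt ℂ f z) →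
      DifferentiableAt ℂ (dslope f z₀) z₀ := by
    intro f hf
    have h1 : DifferentiableOn ℂ f {z | DifferentiableAt ℂ f z} :=
      fun z hz => hz.differentiableWithinAt
    exact ((Complex.differentiableOn_dslope hf).2 h1).differentiableAt hf
  have h2 : DifferentiableAt ℂ (fun z => dslope a z₀ z / dslope b z₀ z) z₀ :=
    (key ha).div (key hb) (by rwa [dslope_same])
  refine h2.congr_of_eventuallyEq ?_
  rw [eventually_nhdsWithin_iff] at hF
  filter_upwards [hF] with z hz
  rcases eq_or_ne z z₀ with rfl | hne
  · rw [dslope_same, dslope_same, hF0]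
  · have h3 : z - z₀ ≠ 0 := sub_ne_zero.2 hne
    rw [hz hne, dslope_of_ne _ hne, dslope_of_ne _ hne, slope_def_field, slope_def_field, ha0, hb0,
      sub_zero, sub_zero, div_div_div_cancel_right₀ h3]

/-- An entire function with values in the slit plane is constant. -/
theorem exists_eq_const_of_mem_slitPlane {F : ℂ → ℂ} (hF : Differentiable ℂ F)
    (h : ∀ z, F z ∈ Complex.slitPlane) : ∃ C, ∀ z, F z = C := by
  set G : ℂ → ℂ := fun z => Complex.exp (Complex.log (F z) * (1 / 2)) with hG
  have hGd : Differentiable ℂ G := fun z =>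
    (((hF z).clog (h z)).mul_const _).cexp
  have hsq : ∀ z, G z ^ 2 = F z := by
    intro z
    rw [hG, ← Complex.exp_nat_mul, Nat.cast_ofNat, mul_left_comm, mul_one_div_cancel two_ne_zero,
      mul_one, Complex.exp_log (Complex.slitPlane_ne_zero (h z))]
  have hre : ∀ z, 0 < (G z).re := by
    intro z
    rw [hG]
    simp only [Complex.exp_re]
    refine mul_pos (Real.exp_pos _) (Real.cos_pos_of_mem_Ioo ?_)
    have h1 : (Complex.log (F z) * (1 / 2)).im = (F z).arg / 2 := by
      rw [show (1 / 2 : ℂ) = ((1 / 2 : ℝ) : ℂ) by push_cast; rfl, Complex.im_mul_ofReal,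
        Complex.log_im]
      ring
    rw [h1]
    have h2 := Complex.neg_pi_lt_arg (F z)
    have h3 := lt_of_le_of_ne (Complex.arg_le_pi (F z))
      (Complex.mem_slitPlane_iff_arg.1 (h z)).1
    constructor <;> linarith
  have hne : ∀ z, 1 + G z ≠ 0 := fun z h0 => by
    have h1 := congrArg Complex.re h0
    simp only [Complex.add_re, Complex.one_re, Complex.zero_re] at h1
    linarith [hre z]
  have hd : Differentiable ℂ fun z => (1 + G z)⁻¹ :=
    ((differentiable_const 1).add hGd).inv hne
  have hb : Bornology.IsBounded (Set.range fun z => (1 + G z)⁻¹) := by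
    rw [isBounded_iff_forall_norm_le]
    refine ⟨1, ?_⟩
    rintro _ ⟨z, rfl⟩
    simp only [norm_inv]
    refine inv_le_one_of_one_le₀ ?_
    refine le_trans ?_ (Complex.re_le_norm _)
    rw [Complex.add_re, Complex.one_re]
    linarith [hre z]
  refine ⟨F 0, fun z => ?_⟩
  have h1 := hd.apply_eq_apply_of_bounded hb z 0
  rw [← hsq z, ← hsq 0, add_left_cancel (inv_injective h1)]

/-! ### Weyl pairs and the uniqueness of m up to a factor -/

/-- The properties of a Weyl function `m`, defined on the complement `U` of its poles, and of its
reciprocal `w`, defined on the complement `V` of the zeros of `m`. -/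
structure IsWeylPair (U V : Set ℂ) (m w : ℂ → ℂ) : Prop where
  isOpen_left : IsOpen U
  isOpen_right : IsOpen V
  mem_or : ∀ z, z ∈ U ∨ z ∈ V
  mem_of_im_ne_zero : ∀ z : ℂ, z.im ≠ 0 → z ∈ U ∧ z ∈ V
  differentiableAt_left : ∀ z ∈ U, DifferentiableAt ℂ m z
  differentiableAt_right : ∀ z ∈ V, DifferentiableAt ℂ w z
  deriv_left : ∀ z ∈ U, z.im = 0 → ∃ c : ℝ, 0 < c ∧ deriv m z = c
  deriv_right : ∀ z ∈ V, z.im = 0 → ∃ c : ℝ, c < 0 ∧ deriv w z = c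
  eq_zero_left : ∀ z ∈ U, m z = 0 ↔ z ∉ V
  eq_zero_right : ∀ z ∈ V, w z = 0 ↔ z ∉ U
  mul_eq_one : ∀ z ∈ U, z ∈ V → m z * w z = 1
  im_left : ∀ z ∈ U, ∃ c : ℝ, 0 < c ∧ (m z).im = z.im * c

variable {U V : Set ℂ} {m₁ w₁ m₂ w₂ : ℂ → ℂ}

open Classical in
/-- The quotient of two functions `m₁`, `m₂` with the same zeros and poles, holomorphically
extended. -/
def weylQuotient (U V : Set ℂ) (m₁ w₁ m₂ w₂ : ℂ → ℂ) (z : ℂ) : ℂ :=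
  if z ∈ U then if z ∈ V then m₁ z / m₂ z else deriv m₁ z / deriv m₂ z
  else deriv w₂ z / deriv w₁ z

/-- Common zeros are real and simple, because the derivative there is not 0, so they cancel; at
poles the same applies to m₁/m₂ = w₂/w₁. -/
theorem differentiable_weylQuotient (h₁ : IsWeylPair U V m₁ w₁) (h₂ : IsWeylPair U V m₂ w₂) :
    Differentiable ℂ (weylQuotient U V m₁ w₁ m₂ w₂) := by
  intro z
  have hUV : ∀ ζ, ζ ∈ U → ζ ∈ V → weylQuotient U V m₁ w₁ m₂ w₂ ζ = m₁ ζ / m₂ ζ := fun ζ h h' => by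
    rw [weylQuotient, if_pos h, if_pos h']
  by_cases hU : z ∈ U
  · by_cases hV : z ∈ V
    · have hm : m₂ z ≠ 0 := fun h => (h₂.eq_zero_left z hU).1 h hV
      refine ((h₁.differentiableAt_left z hU).div (h₂.differentiableAt_left z hU)
        hm).congr_of_eventuallyEq ?_
      filter_upwards [h₁.isOpen_left.mem_nhds hU, h₁.isOpen_right.mem_nhds hV] with ζ h h'
      exact hUV ζ h h'
    · have hr : z.im = 0 := by
        by_contra h
        exact hV (h₁.mem_of_im_ne_zero z h).2
      obtain ⟨c, hc, hc'⟩ := h₂.deriv_left z hU hr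
      have hd : deriv m₂ z ≠ 0 := by rw [hc']; exact_mod_cast hc.ne'
      have hUn := h₁.isOpen_left.mem_nhds hU
      refine differentiableAt_div_of_simple_zero (a := m₁) (b := m₂) ?_ ?_
        ((h₁.eq_zero_left z hU).2 hV) ((h₂.eq_zero_left z hU).2 hV) hd ?_ ?_
      · filter_upwards [hUn] with ζ h using h₁.differentiableAt_left ζ h
      · filter_upwards [hUn] with ζ h using h₂.differentiableAt_left ζ h
      · filter_upwards [mem_nhdsWithin_of_mem_nhds hUn,
          (h₂.differentiableAt_left z hU).hasDerivAt.eventually_ne (c := 0) hd] with ζ h h'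
        refine hUV ζ h ?_
        by_contra h3
        exact h' ((h₂.eq_zero_left ζ h).2 h3)
      · rw [weylQuotient, if_pos hU, if_neg hV]
  · have hV : z ∈ V := (h₁.mem_or z).resolve_left hU
    have hr : z.im = 0 := by
      by_contra h
      exact hU (h₁.mem_of_im_ne_zero z h).1
    obtain ⟨c, hc, hc'⟩ := h₁.deriv_right z hV hr
    have hd : deriv w₁ z ≠ 0 := by rw [hc']; exact_mod_cast hc.ne
    have hVn := h₁.isOpen_right.mem_nhds hV
    refine differentiableAt_div_of_simple_zero (a := w₂) (b := w₁) ?_ ?_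
      ((h₂.eq_zero_right z hV).2 hU) ((h₁.eq_zero_right z hV).2 hU) hd ?_ ?_
    · filter_upwards [hVn] with ζ h using h₂.differentiableAt_right ζ h
    · filter_upwards [hVn] with ζ h using h₁.differentiableAt_right ζ h
    · filter_upwards [mem_nhdsWithin_of_mem_nhds hVn,
        (h₁.differentiableAt_right z hV).hasDerivAt.eventually_ne (c := 0) hd] with ζ h h'
      have h3 : ζ ∈ U := by
        by_contra h3
        exact h' ((h₁.eq_zero_right ζ h).2 h3)
      have h4 := h₁.mul_eq_one ζ h3 h
      have h5 := h₂.mul_eq_one ζ h3 h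
      rw [hUV ζ h3 h, eq_inv_of_mul_eq_one_left h4, eq_inv_of_mul_eq_one_left h5,
        inv_div_inv]
    · rw [weylQuotient, if_neg hU]

theorem im_weylQuotient (h₁ : IsWeylPair U V m₁ w₁) (h₂ : IsWeylPair U V m₂ w₂) (x : ℝ) :
    (weylQuotient U V m₁ w₁ m₂ w₂ x).im = 0 ∧ weylQuotient U V m₁ w₁ m₂ w₂ x ≠ 0 ∧
      ((x : ℂ) ∉ U → 0 < (weylQuotient U V m₁ w₁ m₂ w₂ x).re) := by
  have hr : (x : ℂ).im = 0 := Complex.ofReal_im x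
  by_cases hU : (x : ℂ) ∈ U
  · by_cases hV : (x : ℂ) ∈ V
    · rw [weylQuotient, if_pos hU, if_pos hV]
      obtain ⟨c₁, -, h1⟩ := h₁.im_left _ hU
      obtain ⟨c₂, -, h2⟩ := h₂.im_left _ hU
      rw [hr, zero_mul] at h1 h2
      refine ⟨by rw [Complex.div_im, h1, h2]; simp, div_ne_zero ?_ ?_, fun h => absurd hU h⟩
      · exact fun h => (h₁.eq_zero_left _ hU).1 h hV
      · exact fun h => (h₂.eq_zero_left _ hU).1 h hV
    · rw [weylQuotient, if_pos hU, if_neg hV]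
      obtain ⟨c₁, hc₁, h1⟩ := h₁.deriv_left _ hU hr
      obtain ⟨c₂, hc₂, h2⟩ := h₂.deriv_left _ hU hr
      rw [h1, h2, ← Complex.ofReal_div]
      refine ⟨Complex.ofReal_im _, ?_, fun h => absurd hU h⟩
      exact_mod_cast (div_pos hc₁ hc₂).ne'
  · have hV := (h₁.mem_or x).resolve_left hU
    rw [weylQuotient, if_neg hU]
    obtain ⟨c₁, hc₁, h1⟩ := h₁.deriv_right _ hV hr
    obtain ⟨c₂, hc₂, h2⟩ := h₂.deriv_right _ hV hr
    rw [h1, h2, ← Complex.ofReal_div]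
    refine ⟨Complex.ofReal_im _, ?_, fun _ => ?_⟩
    · exact_mod_cast (div_pos_of_neg_of_neg hc₂ hc₁).ne'
    · rw [Complex.ofReal_re]
      exact div_pos_of_neg_of_neg hc₂ hc₁

/-- A Weyl function is determined, up to a constant factor, by its zeros and poles. -/
theorem IsWeylPair.eq_const_mul (h₁ : IsWeylPair U V m₁ w₁) (h₂ : IsWeylPair U V m₂ w₂)
    (hU : U ≠ Set.univ) : ∃ C, ∀ z : ℂ, z.im ≠ 0 → m₁ z = C * m₂ z := by
  have hF := differentiable_weylQuotient h₁ h₂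
  have hreal := im_weylQuotient h₁ h₂
  have hnonreal : ∀ z : ℂ, z.im ≠ 0 → weylQuotient U V m₁ w₁ m₂ w₂ z = m₁ z / m₂ z := fun z hz => by
    rw [weylQuotient, if_pos (h₁.mem_of_im_ne_zero z hz).1, if_pos (h₁.mem_of_im_ne_zero z hz).2]
  set F := weylQuotient U V m₁ w₁ m₂ w₂
  have hm : ∀ z : ℂ, z.im ≠ 0 → m₂ z ≠ 0 := fun z hz h0 =>
    (h₂.eq_zero_left z (h₂.mem_of_im_ne_zero z hz).1).1 h0 (h₂.mem_of_im_ne_zero z hz).2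
  -- F is real and nonvanishing on the line and positive at a pole, so by the intermediate value
  -- theorem it never changes sign.
  have hpos : ∀ x : ℝ, 0 < (F x).re := by
    obtain ⟨z, hz⟩ := (Set.ne_univ_iff_exists_notMem U).1 hU
    have hzr : z = (z.re : ℂ) := by
      refine Complex.ext (by simp) ?_
      by_contra h
      exact hz (h₁.mem_of_im_ne_zero z (by simpa using h)).1
    have hz0 := (hreal z.re).2.2 (hzr ▸ hz)
    have hcont : Continuous fun x : ℝ => (F x).re :=
      Complex.continuous_re.comp (hF.continuous.comp Complex.continuous_ofReal)
    intro x
    by_contra hx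
    obtain ⟨y, hy⟩ := mem_range_of_exists_le_of_exists_ge hcont ⟨x, not_lt.1 hx⟩ ⟨z.re, hz0.le⟩
    exact (hreal y).2.1 (Complex.ext hy (hreal y).1)
  obtain ⟨C, hC⟩ := exists_eq_const_of_mem_slitPlane hF fun z => by
    by_cases hz : z.im = 0
    · have : z = (z.re : ℂ) := Complex.ext (by simp) (by simpa using hz)
      rw [this]
      exact Or.inl (hpos _)
    · rw [hnonreal z hz]
      by_contra hs
      obtain ⟨hs1, hs2⟩ : (m₁ z / m₂ z).re ≤ 0 ∧ (m₁ z / m₂ z).im = 0 := by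
        rw [Complex.mem_slitPlane_iff, not_or, not_lt, not_not] at hs
        exact hs
      -- A nonpositive ratio is impossible, since Im m₁ and Im m₂ are both nonzero with the sign of
      -- Im z.
      obtain ⟨c₁, hc₁, e1⟩ := h₁.im_left _ (h₁.mem_of_im_ne_zero z hz).1
      obtain ⟨c₂, hc₂, e2⟩ := h₂.im_left _ (h₁.mem_of_im_ne_zero z hz).1
      have h3 : m₁ z = (m₁ z / m₂ z) * m₂ z := (div_mul_cancel₀ _ (hm z hz)).symm
      have h4 := congrArg Complex.im h3
      rw [Complex.mul_im, hs2, zero_mul, add_zero, e1, e2, mul_left_comm] at h4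
      have h5 := mul_left_cancel₀ hz h4
      nlinarith
  refine ⟨C, fun z hz => ?_⟩
  rw [← hC z, hnonreal z hz, div_mul_cancel₀ _ (hm z hz)]

/-! ### The Weyl pair of a Jacobi operator with discrete spectrum -/

namespace JacobiMatrix

variable {J : JacobiMatrix} {D : Submodule ℂ H}

/-- Discreteness is needed only for the full operator: a point of its spectrum is an isolated
eigenvalue, hence regular for the truncated one. -/
theorem isWeylPair (h : J.IsRealization D)
    (hd : HasDiscreteSpectrum (J.restrictedOperator D)) :
    IsWeylPair (resolventSet (J.restrictedOperator D))
      (resolventSet (J.tail.restrictedOperator (tailCondition D))) (J.weylFn D) (J.weylInv D) := by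
  have hsolve : ∀ z ∉ resolventSet (J.restrictedOperator D), ∃ u : H, u ≠ 0 ∧
      J.Solves D z u 0 := by
    intro z hz
    obtain ⟨u, hu, hu0⟩ := Submodule.exists_mem_ne_zero_of_ne_bot (hd.1 z hz).1
    refine ⟨u, fun h0 => hu0 (Subtype.ext h0), solves_iff.2 ⟨u.2, ?_⟩⟩
    exact LinearMap.mem_ker.1 hu
  have hmem : ∀ z ∉ resolventSet (J.restrictedOperator D),
      z ∈ resolventSet (J.tail.restrictedOperator (tailCondition D)) := fun z hz => by
    obtain ⟨u, hu0, hu⟩ := hsolve z hz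
    exact mem_resolventSet_tail_of_eigenvalue h (hd.2 z) hu hu0
  have hw : ∀ z ∈ resolventSet (J.tail.restrictedOperator (tailCondition D)), ∀ c,
      HasDerivAt (J.tail.weylFn (tailCondition D)) c z →
      HasDerivAt (J.weylInv D) (-1 - J.b 0 ^ 2 * c) z := by
    intro z hz c hc
    exact ((hasDerivAt_id z).const_sub (J.q 0 : ℂ)).sub (hc.const_mul ((J.b 0 : ℂ) ^ 2))
  exact
  { isOpen_left := isOpen_resolventSet _
    isOpen_right := isOpen_resolventSet _
    mem_or := fun z => or_iff_not_imp_left.2 (hmem z)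
    mem_of_im_ne_zero := fun z hz => ⟨h.mem_of_im_ne_zero z hz, h.tail.mem_of_im_ne_zero z hz⟩
    differentiableAt_left := fun z hz => (hasDerivAt_weyl hz).differentiableAt
    differentiableAt_right := fun z hz => (hw z hz _ (hasDerivAt_weyl hz)).differentiableAt
    deriv_left := fun z hz hr => ⟨_, pow_pos (norm_resolvent_e0_pos hz) 2,
      (hasDerivAt_weyl_real h.symmetric hz hr).deriv⟩
    deriv_right := fun z hz hr => by
      have h1 := (hw z hz _ (hasDerivAt_weyl_real h.tail.symmetric hz hr)).deriv
      refine ⟨-1 - J.b 0 ^ 2 *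
        ‖resolvent (J.tail.restrictedOperator (tailCondition D)) z e0‖ ^ 2, ?_, ?_⟩
      · have : 0 ≤ J.b 0 ^ 2 *
          ‖resolvent (J.tail.restrictedOperator (tailCondition D)) z e0‖ ^ 2 := by positivity
        linarith
      · rw [h1]; push_cast; rfl
    eq_zero_left := fun z hz => by
      constructor
      · intro h0 hV
        have := weylFn_mul_weylInv h.finSeq_le hz hV
        rw [h0, zero_mul] at this
        exact zero_ne_one this
      · intro hV
        by_contra h0
        exact hV (mem_resolventSet_tail_of_weylFn_ne_zero h.finSeq_le hz h0)
    eq_zero_right := fun z hz => by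
      constructor
      · intro h0 hU
        have := weylFn_mul_weylInv h.finSeq_le hU hz
        rw [h0, mul_zero] at this
        exact zero_ne_one this
      · intro hU
        obtain ⟨u, hu0, hu⟩ := hsolve z hU
        exact weylInv_eq_zero h.finSeq_le hz hu hu0
    mul_eq_one := fun z hU hV => weylFn_mul_weylInv h.finSeq_le hU hV
    im_left := fun z hz => ⟨_, pow_pos (norm_resolvent_e0_pos hz) 2, im_weyl h.symmetric hz⟩ }

end JacobiMatrix

namespace JacobiMatrix

/-! ### The Jacobi matrix is determined by its Weyl function -/

section Strip

variable {J J₁ J₂ : JacobiMatrix} {D D₁ D₂ : Submodule ℂ H}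

theorem im_natCast_mul_I_ne_zero (n : ℕ) : (((n : ℂ) + 1) * Complex.I).im ≠ 0 := by
  simp
  positivity

theorem tendsto_weylFn_imaginary (h : J.IsRealization D) :
    Tendsto (fun n : ℕ => J.weylFn D (((n : ℂ) + 1) * Complex.I)) atTop (𝓝 0) := by
  refine squeeze_zero_norm (fun n => ?_) tendsto_one_div_add_atTop_nhds_zero_nat
  have h1 := norm_weyl_le h.symmetric (h.mem_of_im_ne_zero _ (im_natCast_mul_I_ne_zero n))
  have h2 : (((n : ℂ) + 1) * Complex.I).im = (n : ℝ) + 1 := by simp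
  have h3 : (0 : ℝ) < (n : ℝ) + 1 := by positivity
  rw [h2, abs_of_pos h3] at h1
  rw [le_div_iff₀' h3]
  exact h1

theorem weylFn_mul_weylInv_of_im_ne_zero (h : J.IsRealization D) {z : ℂ} (hz : z.im ≠ 0) :
    J.weylFn D z * J.weylInv D z = 1 :=
  weylFn_mul_weylInv h.finSeq_le (h.mem_of_im_ne_zero z hz) (h.tail.mem_of_im_ne_zero z hz)

/-- Proportional Weyl functions have proportionality constant `1`. -/
theorem eq_and_tail_of_weylFn_proportional (h₁ : J₁.IsRealization D₁)
    (h₂ : J₂.IsRealization D₂) {α₁ α₂ : ℂ}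
    (hα : α₁ ≠ 0) (h : ∀ z : ℂ, z.im ≠ 0 → α₁ * J₁.weylFn D₁ z = α₂ * J₂.weylFn D₂ z) :
    α₁ = α₂ ∧ J₁.q 0 = J₂.q 0 ∧ ∀ z : ℂ, z.im ≠ 0 →
      (J₁.b 0 ^ 2 : ℂ) * J₁.tail.weylFn (tailCondition D₁) z =
        J₂.b 0 ^ 2 * J₂.tail.weylFn (tailCondition D₂) z := by
  have key : ∀ z : ℂ, z.im ≠ 0 → α₁ * J₂.weylInv D₂ z = α₂ * J₁.weylInv D₁ z := by
    intro z hz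
    have e1 := weylFn_mul_weylInv_of_im_ne_zero h₁ hz
    have e2 := weylFn_mul_weylInv_of_im_ne_zero h₂ hz
    linear_combination J₁.weylInv D₁ z * J₂.weylInv D₂ z * h z hz -
      α₁ * J₂.weylInv D₂ z * e1 + α₂ * J₁.weylInv D₁ z * e2
  simp only [weylInv] at key
  set c : ℂ := α₁ * J₂.q 0 - α₂ * J₁.q 0 with hc
  set r : ℂ → ℂ := fun z => α₁ * (J₂.b 0 ^ 2 * J₂.tail.weylFn (tailCondition D₂) z) -
    α₂ * (J₁.b 0 ^ 2 * J₁.tail.weylFn (tailCondition D₁) z) with hr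
  have hr0 : Tendsto (fun n : ℕ => r (((n : ℂ) + 1) * Complex.I)) atTop (𝓝 0) := by
    have := (((tendsto_weylFn_imaginary h₂.tail).const_mul ((J₂.b 0 : ℂ) ^ 2)).const_mul α₁).sub
      (((tendsto_weylFn_imaginary h₁.tail).const_mul ((J₁.b 0 : ℂ) ^ 2)).const_mul α₂)
    simpa only [mul_zero, sub_zero] using this
  -- A linear function equals a constant up to r, which tends to 0 along z = (n + 1)i: dividing by n
  -- + 1 gives α₁ = α₂, and then the limit gives c = 0.
  have hlin : ∀ z : ℂ, z.im ≠ 0 → (α₁ - α₂) * z = c - r z := by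
    intro z hz
    rw [hc, hr]
    linear_combination -(key z hz)
  have hαα : α₁ = α₂ := by
    have t1 : Tendsto (fun n : ℕ => ((n : ℂ) + 1)⁻¹) atTop (𝓝 0) := by
      simpa using tendsto_one_div_add_atTop_nhds_zero_nat (𝕜 := ℂ)
    have t2 := ((tendsto_const_nhds (x := c)).sub hr0).mul t1
    rw [mul_zero] at t2
    have t3 : Tendsto (fun _ : ℕ => (α₁ - α₂) * Complex.I) atTop (𝓝 0) := by
      refine t2.congr fun n => ?_
      rw [← hlin _ (im_natCast_mul_I_ne_zero n)]
      have : (n : ℂ) + 1 ≠ 0 := Nat.cast_add_one_ne_zero n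
      field_simp
    have t4 := tendsto_nhds_unique t3 tendsto_const_nhds
    exact sub_eq_zero.1 ((mul_eq_zero.1 t4.symm).resolve_right Complex.I_ne_zero)
  have hc0 : c = 0 := by
    refine tendsto_nhds_unique (hr0.congr fun n => ?_) tendsto_const_nhds |>.symm
    have := hlin _ (im_natCast_mul_I_ne_zero n)
    rw [hαα, sub_self, zero_mul] at this
    exact (sub_eq_zero.1 this.symm).symm
  refine ⟨hαα, ?_, fun z hz => ?_⟩
  · rw [hc, ← hαα, ← mul_sub, mul_eq_zero, sub_eq_zero] at hc0
    exact (Complex.ofReal_injective (hc0.resolve_left hα)).symm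
  · have h1 := hlin z hz
    simp only [hc0, hr, ← hαα] at h1
    refine mul_left_cancel₀ hα ?_
    linear_combination -h1

/-- Removing a row only yields equality of b₀² m₁, so the induction carries the factors α₁, α₂. -/
theorem entries_eq_of_weylFn (n : ℕ) : ∀ {J₁ J₂ : JacobiMatrix} {D₁ D₂ : Submodule ℂ H} {α₁ α₂ : ℂ},
    J₁.IsRealization D₁ → J₂.IsRealization D₂ → α₁ ≠ 0 →
    (∀ z : ℂ, z.im ≠ 0 → α₁ * J₁.weylFn D₁ z = α₂ * J₂.weylFn D₂ z) →
    J₁.q n = J₂.q n ∧ J₁.b n = J₂.b n := by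
  induction n with
  | zero =>
    intro J₁ J₂ D₁ D₂ α₁ α₂ h₁ h₂ hα h
    obtain ⟨-, hq, h'⟩ := eq_and_tail_of_weylFn_proportional h₁ h₂ hα h
    -- Here the factors are the two b₀², so their equality is that of the b₀.
    obtain ⟨hb, -, -⟩ := eq_and_tail_of_weylFn_proportional h₁.tail h₂.tail
      (pow_ne_zero 2 (J₁.b_ne_zero 0)) h'
    have hb' : J₁.b 0 ^ 2 = J₂.b 0 ^ 2 := by exact_mod_cast hb
    exact ⟨hq, (pow_left_inj₀ (J₁.b_pos 0).le (J₂.b_pos 0).le two_ne_zero).1 hb'⟩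
  | succ n ih =>
    intro J₁ J₂ D₁ D₂ α₁ α₂ h₁ h₂ hα h
    exact ih h₁.tail h₂.tail (pow_ne_zero 2 (J₁.b_ne_zero 0))
      (eq_and_tail_of_weylFn_proportional h₁ h₂ hα h).2.2

theorem eq_of_weylFn (h₁ : J₁.IsRealization D₁) (h₂ : J₂.IsRealization D₂)
    (h : ∀ z : ℂ, z.im ≠ 0 → J₁.weylFn D₁ z = J₂.weylFn D₂ z) : J₁ = J₂ := by
  have key := fun n => entries_eq_of_weylFn n h₁ h₂ (one_ne_zero (α := ℂ)) (α₂ := 1)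
    (fun z hz => by rw [h z hz])
  obtain ⟨q₁, b₁, hb₁⟩ := J₁
  obtain ⟨q₂, b₂, hb₂⟩ := J₂
  obtain rfl : q₁ = q₂ := funext fun n => (key n).1
  obtain rfl : b₁ = b₂ := funext fun n => (key n).2
  rfl

/-- Realizations of the same matrix with the same Weyl function have the same resolvent at the first
unit vector. -/
theorem resolvent_e0_eq {z : ℂ} (h₁ : z ∈ resolventSet (J.restrictedOperator D₁))
    (h₂ : z ∈ resolventSet (J.restrictedOperator D₂)) (h : J.weylFn D₁ z = J.weylFn D₂ z) :
    resolvent (J.restrictedOperator D₁) z e0 = resolvent (J.restrictedOperator D₂) z e0 := by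
  have e1 : J.Solves ⊤ z _ _ := ⟨trivial, (solves_resolvent h₁ e0).2⟩
  have e2 : J.Solves ⊤ z _ _ := ⟨trivial, (solves_resolvent h₂ e0).2⟩
  have e3 := e1.add (e2.smul (-1))
  rw [neg_one_smul, neg_one_smul, add_neg_cancel] at e3
  rw [← sub_eq_zero, sub_eq_add_neg]
  refine e3.eq_zero ?_
  rw [weylFn_eq, weylFn_eq] at h
  rw [← neg_one_smul ℂ, coe_add_apply, coe_smul_apply, h]
  ring

end Strip

/-! ### The operators of the inverse problem -/

variable (J : JacobiMatrix)

theorem neumannOperator_eq (g : WithTop ℝ) : J.neumannOperator g =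
    J.tail.restrictedOperator (tailCondition (J.effectiveCondition g)) := by
  unfold neumannOperator effectiveCondition restrictedOperator
  split_ifs with h
  · rw [show tailCondition (⊤ : Submodule ℂ H) = ⊤ from rfl, domRestrict_top]
  · rfl

theorem finSeq_le_effectiveCondition (g : WithTop ℝ) : finSeq ≤ J.effectiveCondition g := by
  unfold effectiveCondition
  split_ifs with h
  · exact le_top
  · intro f hf
    obtain ⟨N, hN⟩ := Set.Finite.bddAbove hf
    have h0 : ∀ k, N < k → f k = 0 := fun k hk => by
      by_contra h
      exact absurd (hN h) (by omega)
    refine tendsto_const_nhds.congr' ?_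
    filter_upwards [eventually_gt_atTop N] with n hn
    rw [wronskian, h0 n hn, h0 (n + 1) (by omega)]
    ring

/-- Every spectral point is an eigenvalue by discreteness, and eigenvalues of a symmetric operator
are real. -/
theorem isRealization_effectiveCondition {g : WithTop ℝ}
    (hd : HasDiscreteSpectrum (J.restrictedOperator (J.effectiveCondition g))) :
    J.IsRealization (J.effectiveCondition g) := by
  have hs := J.dirichletOperator_isFormalAdjoint g
  rw [dirichletOperator_eq] at hs
  refine ⟨J.finSeq_le_effectiveCondition g, hs, fun z hz => ?_⟩
  by_contra h
  obtain ⟨u, hu, hu0⟩ := Submodule.exists_mem_ne_zero_of_ne_bot (hd.1 z h).1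
  exact hz (eigenvalue_im_eq_zero hs (fun h0 => hu0 (Subtype.ext h0))
    (sub_eq_zero.1 (LinearMap.mem_ker.1 hu)))

/-- The Weyl function determines the boundary condition at infinity. -/
theorem boundaryCondition_eq_of_weylFn (hJ : ¬ IsSelfAdjoint J.operator) {g₁ g₂ : WithTop ℝ}
    (h₁ : J.IsRealization (J.effectiveCondition g₁))
    (h₂ : J.IsRealization (J.effectiveCondition g₂))
    (h : J.weylFn (J.effectiveCondition g₁) Complex.I =
      J.weylFn (J.effectiveCondition g₂) Complex.I) : g₁ = g₂ := by
  by_contra hg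
  have m1 := h₁.mem_of_im_ne_zero Complex.I (by simp)
  have m2 := h₂.mem_of_im_ne_zero Complex.I (by simp)
  have s1 := solves_resolvent m1 e0
  have s2 := solves_resolvent m2 e0
  rw [← resolvent_e0_eq m1 m2 h] at s2
  set f := resolvent (J.restrictedOperator (J.effectiveCondition g₁)) Complex.I e0
  have b1 : Tendsto (J.wronskian (J.boundarySeq g₁) f) atTop (𝓝 0) := by
    have := s1.1
    rw [effectiveCondition, if_neg hJ] at this
    exact this
  have b2 : Tendsto (J.wronskian (J.boundarySeq g₂) f) atTop (𝓝 0) := by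
    have := s2.1
    rw [effectiveCondition, if_neg hJ] at this
    exact this
  let p : H := ⟨J.P Complex.I, J.memℓp_P_I hJ⟩
  have hp : J.Solves ⊤ Complex.I p 0 := ⟨trivial, fun k => by
    rw [show ((0 : H) : ℕ → ℂ) k = 0 from rfl, add_zero]
    exact J.diffExpr_P Complex.I k⟩
  obtain ⟨hpm, -⟩ := solves_iff.1 hp
  obtain ⟨l₁, hl₁⟩ := J.exists_tendsto_wronskian_boundarySeq hJ g₁ ⟨p, hpm.2⟩
  obtain ⟨l₂, hl₂⟩ := J.exists_tendsto_wronskian_boundarySeq hJ g₂ ⟨p, hpm.2⟩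
  -- f satisfies both boundary conditions, so the Plücker relation makes its boundary form with P(i)
  -- vanish.
  have hlim : Tendsto (J.wronskian f p) atTop (𝓝 0) := by
    refine J.tendsto_wronskian_zero hg ?_ ?_
    · simpa using b1.mul hl₂
    · simpa using b2.mul hl₁
  -- Both sequences solve the equation at i except for the source e₀ in row 0, which contributes
  -- -P₀(i) = -1.
  have hconst : ∀ n, J.wronskian f p n = -1 := by
    intro n
    have hp0 : p 0 = 1 := rfl
    have hpk : ∀ k, J.diffExpr p k = Complex.I * p k := J.diffExpr_P Complex.I
    induction n with
    | zero =>
      rw [wronskian_zero, hpk, s1.2, e0_apply, if_pos rfl, hp0]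
      ring
    | succ n ih =>
      rw [wronskian_succ, ih, hpk, s1.2, e0_apply, if_neg n.succ_ne_zero]
      ring
  have := tendsto_nhds_unique hlim ((tendsto_const_nhds (x := (-1 : ℂ))).congr fun n =>
    (hconst n).symm)
  norm_num at this

end JacobiMatrix

end JacobiTwoSpectra

end

/-! ### The two-spectra theorem -/

open JacobiTwoSpectra JacobiMatrix in
theorem mainTheorem4 (J₁ J₂ : JacobiTwoSpectra.JacobiMatrix) (g₁ g₂ : WithTop ℝ)
    (hd₁ : JacobiTwoSpectra.HasDiscreteSpectrum (J₁.dirichletOperator g₁))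
    (hd₂ : JacobiTwoSpectra.HasDiscreteSpectrum (J₂.dirichletOperator g₂))
    (hDirichlet : JacobiTwoSpectra.spectrum (J₁.dirichletOperator g₁) =
      JacobiTwoSpectra.spectrum (J₂.dirichletOperator g₂))
    (hNeumann : JacobiTwoSpectra.spectrum (J₁.neumannOperator g₁) =
      JacobiTwoSpectra.spectrum (J₂.neumannOperator g₂)) :
    J₁ = J₂ ∧ (¬ IsSelfAdjoint J₁.operator → g₁ = g₂) := by
  rw [dirichletOperator_eq] at hd₁ hd₂
  rw [dirichletOperator_eq, dirichletOperator_eq] at hDirichlet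
  rw [neumannOperator_eq, neumannOperator_eq] at hNeumann
  have h₁ := J₁.isRealization_effectiveCondition hd₁
  have h₂ := J₂.isRealization_effectiveCondition hd₂
  have w₁ := isWeylPair h₁ hd₁
  have w₂ := isWeylPair h₂ hd₂
  -- Equality of the spectra puts both Weyl pairs on the same sets U and V.
  rw [← compl_inj_iff.1 hDirichlet, ← compl_inj_iff.1 hNeumann] at w₂
  have hU : resolventSet (J₁.restrictedOperator (J₁.effectiveCondition g₁)) ≠ Set.univ := by
    intro h
    have := spectrum_nonempty h₁.symmetric
    rw [JacobiTwoSpectra.spectrum, h, Set.compl_univ] at this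
    exact Set.not_nonempty_empty this
  obtain ⟨C, hC⟩ := w₁.eq_const_mul w₂ hU
  obtain ⟨hC1, -, -⟩ := eq_and_tail_of_weylFn_proportional h₁ h₂ (one_ne_zero (α := ℂ)) (α₂ := C)
    (fun z hz => by rw [one_mul, hC z hz])
  have hm : ∀ z : ℂ, z.im ≠ 0 → J₁.weylFn (J₁.effectiveCondition g₁) z =
      J₂.weylFn (J₂.effectiveCondition g₂) z := fun z hz => by rw [hC z hz, ← hC1, one_mul]
  obtain rfl := eq_of_weylFn h₁ h₂ hm
  exact ⟨rfl, fun hJ => J₁.boundaryCondition_eq_of_weylFn hJ h₁ h₂ (hm Complex.I (by simp))⟩
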